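/- Let $\mathbb K$ be a field of characteristic zero and let $B_k$ be the Bernoulli numbers, with $B_1=-\tfrac12$. Let $\alpha,\beta,x$ be generators of degrees $|\alpha|=|\beta|=-1$, $|x|=0$, and let $V$ be the graded vector space with basis $\alpha,\beta,x$. Let $\widehat T(\alpha,\beta,x)=\prod_{n\ge0}V^{\otimes n}$ be the complete tensor algebra and $\widehat{\mathbb L}(\alpha,\beta,x)=\prod_{n\ge1}\mathbb L^n\subset\widehat T(\alpha,\beta,x)$ the complete free graded Lie algebra, where $\mathbb L^n\subset V^{\otimes n}$ is spanned by the iterated graded commutators of $n$ generators (both products are taken in graded vector spaces, that is, degree by degree). Differentials have degree $-1$; put $\mathrm{ad}_x(u)=[x,u]$. Then the following three statements are equivalent. 1. (Euler-type identities.) For every even integer $n\ge4$ and all integers $a,b,c$ with $a+b+c=n-1$, $$\sum_{k=0}^n\lambda_kB_kB_{n-k}=0,$$ where $$\lambda_k=\binom nk\Bigg[(-1)^c\binom{n-k}{c}\sum_{\ell=\max(0,k-b)}^{\min(a,k)}(-1)^\ell\binom k\ell-(-1)^a\binom{n-k}{a}\sum_{\ell=\max(0,k-b)}^{\min(c,k)}(-1)^\ell\binom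 k\ell\Bigg]$$ (a binomial coefficient with negative lower entry is $0$, and so is an empty sum). 2. (Lawrence–Sullivan.) The element $$\mathrm{ad}_x\beta+\sum_{i\ge0}\frac{B_i}{i!}\,\mathrm{ad}_x^i(\beta-\alpha)$$ is the unique choice of $\partial x$ that makes $\widehat{\mathbb L}(\alpha,\beta,x)$ a differential graded Lie algebra in which $\alpha$ and $\beta$ are Maurer–Cartan elements, $\partial\alpha=-\tfrac12[\alpha,\alpha]$ and $\partial\beta=-\tfrac12[\beta,\beta]$, and in which the flow generated by $x$ moves from $\alpha$ to $\beta$, i.e. the formal power series solution $u(t)$ of $u'(t)=\partial x-\mathrm{ad}_xu(t)$, $u(0)=\alpha$, satisfies $u(1)=\beta$. (That is: such a differential graded Lie algebra structure with this value of $\partial x$ exists, and every such structure has this value of $\partial x$.) 3. (Enveloping algebra version.) $\widehat T(\alpha,\beta,x)$ is a differential graded algebra whose differential $D$ (a graded derivation of degree $-1$ with $D^2=0$) has the values $D\alpha=-\alpha\otimes\alpha$, $D\beta=-\beta\otimes\beta$ and $$Dx=x\otimes\beta-\beta\otimes x+\sum_{k\ge0}\sum_{p+q=k}(-1)^q\frac{B_{p+q}}{p!\,q!}\,x^{\otimes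 p}\otimes(\beta-\alpha)\otimes x^{\otimes q}.$$ -/

import Mathlib

open scoped BigOperators

noncomputable section

/-! ### Euler-type identities -/

/-- The binomial coefficient with an integer lower entry; it is `0` if the lower entry is
negative. -/
def binom (m : ℕ) (r : ℤ) : ℚ := if 0 ≤ r then (m.choose r.toNat : ℚ) else 0

/-- The alternating sum of `(-1) ^ l * binom k l` over `max 0 (k - b) ≤ l ≤ min a k`. -/
def altSum (a b : ℤ) (k : ℕ) : ℚ :=
  ∑ l ∈ Finset.Icc (max 0 ((k : ℤ) - b)) (min a (k : ℤ)), (-1 : ℚ) ^ l * binom k l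

/-- The coefficient `λ_k` (used for `0 ≤ k ≤ n` only). -/
def eulerCoeff (n : ℕ) (a b c : ℤ) (k : ℕ) : ℚ :=
  binom n k * ((-1) ^ c * binom (n - k) c * altSum a b k
    - (-1) ^ a * binom (n - k) a * altSum c b k)

/-- The family of Euler-type identities for the Bernoulli numbers (`B_1 = -1/2`). -/
def EulerTypeIdentities : Prop :=
  ∀ n : ℕ, Even n → 4 ≤ n → ∀ a b c : ℤ, a + b + c = (n : ℤ) - 1 →
    ∑ k ∈ Finset.range (n + 1), eulerCoeff n a b c k * bernoulli k * bernoulli (n - k) = 0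

/-! ### Differential graded Lie algebras and differential graded algebras -/

/-- `L = ⨁ 𝓛 i` with the bracket `br` and the differential `d` (of degree `-1`) is a
differential graded Lie algebra. -/
structure IsDGL {K : Type*} [Field K] {L : Type*} [AddCommGroup L] [Module K L]
    (𝓛 : ℤ → Submodule K L) (br : L →ₗ[K] L →ₗ[K] L) (d : L →ₗ[K] L) : Prop where
  internal : DirectSum.IsInternal 𝓛
  bracket_mem : ∀ (i j : ℤ) (u v : L), u ∈ 𝓛 i → v ∈ 𝓛 j → br u v ∈ 𝓛 (i + j)
  antisymm : ∀ (i j : ℤ) (u v : L), u ∈ 𝓛 i → v ∈ 𝓛 j →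
    br u v = (-1 : K) ^ (i * j + 1) • br v u
  jacobi : ∀ (i j k : ℤ) (u v w : L), u ∈ 𝓛 i → v ∈ 𝓛 j → w ∈ 𝓛 k →
    br u (br v w) = br (br u v) w + (-1 : K) ^ (i * j) • br v (br u w)
  diff_mem : ∀ (i : ℤ) (u : L), u ∈ 𝓛 i → d u ∈ 𝓛 (i - 1)
  leibniz : ∀ (i j : ℤ) (u v : L), u ∈ 𝓛 i → v ∈ 𝓛 j →
    d (br u v) = br (d u) v + (-1 : K) ^ i • br u (d v)
  sq_zero : ∀ u : L, d (d u) = 0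

/-- `A = ⨁ 𝓐 i` with the differential `d` (of degree `-1`) is a differential graded
associative algebra. -/
structure IsDGA {K : Type*} [Field K] {A : Type*} [Ring A] [Algebra K A]
    (𝓐 : ℤ → Submodule K A) (d : A →ₗ[K] A) : Prop where
  internal : DirectSum.IsInternal 𝓐
  one_mem : (1 : A) ∈ 𝓐 0
  mul_mem : ∀ (i j : ℤ) (u v : A), u ∈ 𝓐 i → v ∈ 𝓐 j → u * v ∈ 𝓐 (i + j)
  diff_mem : ∀ (i : ℤ) (u : A), u ∈ 𝓐 i → d u ∈ 𝓐 (i - 1)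
  leibniz : ∀ (i j : ℤ) (u v : A), u ∈ 𝓐 i → v ∈ 𝓐 j →
    d (u * v) = d u * v + (-1 : K) ^ i • (u * d v)
  sq_zero : ∀ u : A, d (d u) = 0

/-- The Maurer-Cartan equation `∂a + ½[a, a] = 0` for an element `a` of degree `-1`. -/
def IsMaurerCartan {K : Type*} [Field K] {L : Type*} [AddCommGroup L] [Module K L]
    (𝓛 : ℤ → Submodule K L) (br : L →ₗ[K] L →ₗ[K] L) (d : L →ₗ[K] L) (a : L) : Prop :=
  a ∈ 𝓛 (-1) ∧ d a + (2⁻¹ : K) • br a a = 0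

/-- The coefficients `u_n` of the formal power series solution `u(t) = ∑ u_n t ^ n` of
`u'(t) = ∂ξ - ad_ξ u(t)`, `u(0) = a`. -/
def flowCoeff {K : Type*} [Field K] {L : Type*} [AddCommGroup L] [Module K L]
    (br : L →ₗ[K] L →ₗ[K] L) (d : L →ₗ[K] L) (ξ a : L) : ℕ → L
  | 0 => a
  | n + 1 => ((n : K) + 1)⁻¹ • ((if n = 0 then d ξ else 0) - br ξ (flowCoeff br d ξ a n))

/-! ### Noncommutative formal power series in `α`, `β`, `x` -/

/-- The three generators. -/
inductive Gen : Type
  | α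
  | β
  | x

/-- The degrees of the generators: `|α| = |β| = -1` and `|x| = 0`. -/
def Gen.deg : Gen → ℤ
  | .α => -1
  | .β => -1
  | .x => 0

/-- The degree of a word, that is, of a tensor product of generators. -/
def wdeg (w : List Gen) : ℤ := (w.map Gen.deg).sum

/-- Noncommutative formal power series in `α, β, x`: the product over all `n` of the tensor
powers `T^n(V)`, where `V` has basis `α, β, x` and hence `T^n(V)` has as basis the words of
length `n`. -/
structure NCSeries (K : Type*) where
  /-- The coefficient of a word. -/
  coeff : List Gen → K

namespace NCSeries

@[ext] theorem ext {K : Type*} {f g : NCSeries K} (h : ∀ w, f.coeff w = g.coeff w) : f = g := by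
  cases f; cases g; congr; exact funext h

/-- Series are the same as functions on words. -/
def equivFun (K : Type*) : NCSeries K ≃ (List Gen → K) := ⟨coeff, mk, fun _ => rfl, fun _ => rfl⟩

variable {K : Type*} [Field K]

instance : AddCommGroup (NCSeries K) := (equivFun K).addCommGroup

instance : Module K (NCSeries K) := (equivFun K).module K

@[simp] theorem add_apply (f g : NCSeries K) (w : List Gen) :
    (f + g).coeff w = f.coeff w + g.coeff w := rfl

@[simp] theorem sub_apply (f g : NCSeries K) (w : List Gen) :
    (f - g).coeff w = f.coeff w - g.coeff w := rfl

@[simp] theorem neg_apply (f : NCSeries K) (w : List Gen) : (-f).coeff w = -f.coeff w := rfl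

@[simp] theorem zero_apply (w : List Gen) : (0 : NCSeries K).coeff w = 0 := rfl

@[simp] theorem smul_apply (r : K) (f : NCSeries K) (w : List Gen) :
    (r • f).coeff w = r * f.coeff w := rfl

theorem sum_apply {ι : Type*} (s : Finset ι) (f : ι → NCSeries K) (w : List Gen) :
    (∑ i ∈ s, f i).coeff w = ∑ i ∈ s, (f i).coeff w := by
  classical
  induction s using Finset.induction_on with
  | empty => simp
  | insert i s hi h => simp [Finset.sum_insert hi, h]

/-- The word `w`, as a series. -/
def word (K : Type*) [Field K] (w : List Gen) : NCSeries K :=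
  open scoped Classical in ⟨fun v => if v = w then 1 else 0⟩

/-- The product extends the concatenation of words: the coefficient at `w` is the sum over all
splittings of `w` in two. -/
instance : Mul (NCSeries K) :=
  ⟨fun f g => ⟨fun w => ∑ i ∈ Finset.range (w.length + 1),
    f.coeff (w.take i) * g.coeff (w.drop i)⟩⟩

instance : One (NCSeries K) := ⟨word K []⟩

theorem mul_apply (f g : NCSeries K) (w : List Gen) :
    (f * g).coeff w = ∑ i ∈ Finset.range (w.length + 1),
      f.coeff (w.take i) * g.coeff (w.drop i) := rfl

theorem one_apply (w : List Gen) [Decidable (w = [])] :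
    (1 : NCSeries K).coeff w = if w = [] then 1 else 0 := by
  change (word K []).coeff w = _
  simp [word]

protected theorem mul_assoc' (f g h : NCSeries K) : f * g * h = f * (g * h) := by
  ext w
  simp only [mul_apply, Finset.sum_mul, Finset.mul_sum, Finset.sum_sigma']
  refine Finset.sum_bij' (fun p _ => ⟨p.2, p.1 - p.2⟩) (fun p _ => ⟨p.1 + p.2, p.1⟩) ?_ ?_ ?_ ?_ ?_
  · rintro ⟨j, i⟩ hp
    simp only [Finset.mem_sigma, Finset.mem_range, List.length_take, List.length_drop] at hp ⊢
    omega
  · rintro ⟨i, k⟩ hp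
    simp only [Finset.mem_sigma, Finset.mem_range, List.length_take, List.length_drop] at hp ⊢
    omega
  · rintro ⟨j, i⟩ hp
    simp only [Finset.mem_sigma, Finset.mem_range, List.length_take] at hp
    have : i + (j - i) = j := by omega
    simp [this]
  · rintro ⟨i, k⟩ hp
    simp
  · rintro ⟨j, i⟩ hp
    simp only [Finset.mem_sigma, Finset.mem_range, List.length_take] at hp
    have h1 : min i j = i := by omega
    have h2 : i + (j - i) = j := by omega
    simp only [List.take_take, List.drop_drop, List.drop_take, h1, h2, mul_assoc]

protected theorem one_mul' (f : NCSeries K) : 1 * f = f := by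
  classical
  ext w
  rw [mul_apply, Finset.sum_eq_single 0]
  · simp [one_apply]
  · intro i hi h0
    have : w.take i ≠ [] := by
      intro h
      have := congrArg List.length h
      simp only [Finset.mem_range] at hi
      simp only [List.length_take, List.length_nil] at this
      omega
    simp [one_apply, this]
  · simp

protected theorem mul_one' (f : NCSeries K) : f * 1 = f := by
  classical
  ext w
  rw [mul_apply, Finset.sum_eq_single w.length]
  · simp [one_apply]
  · intro i hi h0
    have : w.drop i ≠ [] := by
      intro h
      have := congrArg List.length h
      simp only [Finset.mem_range] at hi
      simp only [List.length_drop, List.length_nil] at this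
      omega
    simp [one_apply, this]
  · simp

instance : Ring (NCSeries K) :=
  { (inferInstance : AddCommGroup (NCSeries K)), (inferInstance : Mul (NCSeries K)),
    (inferInstance : One (NCSeries K)) with
    mul_assoc := NCSeries.mul_assoc'
    one_mul := NCSeries.one_mul'
    mul_one := NCSeries.mul_one'
    zero_mul := fun f => by ext w; simp [mul_apply]
    mul_zero := fun f => by ext w; simp [mul_apply]
    left_distrib := fun f g h => by ext w; simp [mul_apply, mul_add, Finset.sum_add_distrib]
    right_distrib := fun f g h => by ext w; simp [mul_apply, add_mul, Finset.sum_add_distrib] }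

instance : Algebra K (NCSeries K) :=
  Algebra.ofModule
    (fun r f g => by ext w; simp [mul_apply, Finset.mul_sum, mul_assoc])
    (fun r f g => by ext w; simp [mul_apply, Finset.mul_sum, mul_left_comm])

/-- The sum of a locally finite sequence of series (each word has a nonzero coefficient in only
finitely many of them). -/
def formalSum (s : ℕ → NCSeries K) : NCSeries K := ⟨fun w => ∑ᶠ i, (s i).coeff w⟩

/-- The series that are homogeneous of degree `d`. -/
def homog (K : Type*) [Field K] (d : ℤ) : Submodule K (NCSeries K) where
  carrier := {f | ∀ w, f.coeff w ≠ 0 → wdeg w = d}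
  zero_mem' := fun w h => absurd rfl h
  add_mem' := fun {f g} hf hg w h => by
    by_cases h1 : f.coeff w = 0
    · exact hg w fun h2 => h (by simp [h1, h2])
    · exact hf w h1
  smul_mem' := fun r f hf w h => hf w fun h1 => h (by simp [h1])

theorem wdeg_take_add_drop (w : List Gen) (i : ℕ) : wdeg (w.take i) + wdeg (w.drop i) = wdeg w := by
  unfold wdeg
  rw [← List.sum_append, ← List.map_append, List.take_append_drop]

/-! ### The complete tensor algebra -/

/-- The complete tensor algebra on `α, β, x`. The product of the `T^n(V)` is taken in graded
vector spaces: its component of degree `d` consists of all the series of degree `d`, and the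
algebra is the direct sum of these components, that is, it consists of the series in which
only finitely many degrees occur. -/
def completeTensor (K : Type*) [Field K] : Subalgebra K (NCSeries K) where
  carrier := {f | ∃ S : Finset ℤ, ∀ w, f.coeff w ≠ 0 → wdeg w ∈ S}
  mul_mem' := by
    rintro f g ⟨S, hS⟩ ⟨T, hT⟩
    refine ⟨(S ×ˢ T).image fun p => p.1 + p.2, fun w h => ?_⟩
    rw [mul_apply] at h
    obtain ⟨i, -, hi⟩ := Finset.exists_ne_zero_of_sum_ne_zero h
    refine Finset.mem_image.2 ⟨(wdeg (w.take i), wdeg (w.drop i)), ?_, wdeg_take_add_drop w i⟩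
    exact Finset.mem_product.2 ⟨hS _ (left_ne_zero_of_mul hi), hT _ (right_ne_zero_of_mul hi)⟩
  add_mem' := by
    rintro f g ⟨S, hS⟩ ⟨T, hT⟩
    refine ⟨S ∪ T, fun w h => ?_⟩
    by_cases h1 : f.coeff w = 0
    · exact Finset.mem_union_right _ (hT w fun h2 => h (by simp [h1, h2]))
    · exact Finset.mem_union_left _ (hS w h1)
  algebraMap_mem' := by
    classical
    intro r
    refine ⟨{0}, fun w h => ?_⟩
    rw [Algebra.algebraMap_eq_smul_one, smul_apply, one_apply] at h
    have : w = [] := by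
      by_contra hw
      simp [hw] at h
    simp [this, wdeg]

theorem word_mem_completeTensor (w : List Gen) : word K w ∈ completeTensor K := by
  refine ⟨{wdeg w}, fun v h => ?_⟩
  have : v = w := by
    by_contra hv
    simp [word, hv] at h
  simp [this]

/-- The component of degree `d` of the complete tensor algebra. -/
def tensorGrading (K : Type*) [Field K] (d : ℤ) : Submodule K (completeTensor K) :=
  (homog K d).comap (completeTensor K).val.toLinearMap

/-- A generator as an element of the complete tensor algebra. -/
def tgen (K : Type*) [Field K] (g : Gen) : completeTensor K :=
  ⟨word K [g], word_mem_completeTensor [g]⟩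

/-! ### The complete free Lie algebra -/

/-- The graded commutator: the bilinear extension of `[u, v] = uv - (-1) ^ (|u||v|) vu`. -/
def gbracket (K : Type*) [Field K] : NCSeries K →ₗ[K] NCSeries K →ₗ[K] NCSeries K :=
  LinearMap.mk₂ K
    (fun f g => ⟨fun w => ∑ i ∈ Finset.range (w.length + 1),
      (f.coeff (w.take i) * g.coeff (w.drop i)
        - (-1 : K) ^ (wdeg (w.drop i) * wdeg (w.take i)) * (g.coeff (w.take i) * f.coeff (w.drop i)))⟩)
    (fun f f' g => by
      ext w; simp only [add_apply, ← Finset.sum_add_distrib]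
      exact Finset.sum_congr rfl fun i _ => by ring)
    (fun r f g => by
      ext w; simp only [smul_apply, Finset.mul_sum]
      exact Finset.sum_congr rfl fun i _ => by ring)
    (fun f g g' => by
      ext w; simp only [add_apply, ← Finset.sum_add_distrib]
      exact Finset.sum_congr rfl fun i _ => by ring)
    (fun r f g => by
      ext w; simp only [smul_apply, Finset.mul_sum]
      exact Finset.sum_congr rfl fun i _ => by ring)

theorem gbracket_apply (f g : NCSeries K) (w : List Gen) :
    (gbracket K f g).coeff w = ∑ i ∈ Finset.range (w.length + 1),
      (f.coeff (w.take i) * g.coeff (w.drop i)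
        - (-1 : K) ^ (wdeg (w.drop i) * wdeg (w.take i)) * (g.coeff (w.take i) * f.coeff (w.drop i))) := rfl

/-- Iterated brackets of the generators. -/
inductive IsLieMonomial (K : Type*) [Field K] : NCSeries K → Prop
  | gen (g : Gen) : IsLieMonomial K (word K [g])
  | bracket {u v : NCSeries K} : IsLieMonomial K u → IsLieMonomial K v →
      IsLieMonomial K (gbracket K u v)

/-- The free graded Lie algebra on `α, β, x`: the graded Lie subalgebra of the tensor algebra
generated by `α, β, x`. -/
def freeLie (K : Type*) [Field K] : Submodule K (NCSeries K) :=
  Submodule.span K {f | IsLieMonomial K f}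

/-- The component of word length `n` of a series. -/
def lengthPart (K : Type*) [Field K] (n : ℕ) : NCSeries K →ₗ[K] NCSeries K where
  toFun f := ⟨fun w => if w.length = n then f.coeff w else 0⟩
  map_add' f g := by ext w; by_cases h : w.length = n <;> simp [h]
  map_smul' r f := by ext w; by_cases h : w.length = n <;> simp [h]

theorem lengthPart_apply (n : ℕ) (f : NCSeries K) (w : List Gen) :
    (lengthPart K n f).coeff w = if w.length = n then f.coeff w else 0 := rfl

/-- The complete free graded Lie algebra on `α, β, x`: the graded product of the components of
word length `n` of the free graded Lie algebra. -/
def completeLie (K : Type*) [Field K] : Submodule K (NCSeries K) where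
  carrier := {f | f ∈ completeTensor K ∧ ∀ n, lengthPart K n f ∈ freeLie K}
  zero_mem' := ⟨zero_mem _, fun n => by simp⟩
  add_mem' := fun hf hg => ⟨add_mem hf.1 hg.1, fun n => by
    rw [map_add]; exact add_mem (hf.2 n) (hg.2 n)⟩
  smul_mem' := fun r f hf => ⟨(completeTensor K).smul_mem hf.1 r, fun n => by
    rw [map_smul]; exact (freeLie K).smul_mem r (hf.2 n)⟩

theorem gbracket_mem_freeLie {f g : NCSeries K} (hf : f ∈ freeLie K) (hg : g ∈ freeLie K) :
    gbracket K f g ∈ freeLie K := by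
  induction hf using Submodule.span_induction with
  | mem u hu =>
    induction hg using Submodule.span_induction with
    | mem v hv => exact Submodule.subset_span (IsLieMonomial.bracket hu hv)
    | zero => simp
    | add v v' _ _ h h' => rw [map_add]; exact add_mem h h'
    | smul r v _ h => rw [map_smul]; exact Submodule.smul_mem _ r h
  | zero => simp
  | add u u' _ _ h h' => rw [map_add, LinearMap.add_apply]; exact add_mem h h'
  | smul r u _ h => rw [map_smul, LinearMap.smul_apply]; exact Submodule.smul_mem _ r h

theorem lengthPart_gbracket (n : ℕ) (f g : NCSeries K) :
    lengthPart K n (gbracket K f g)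
      = ∑ p ∈ Finset.HasAntidiagonal.antidiagonal n, gbracket K (lengthPart K p.1 f) (lengthPart K p.2 g) := by
  ext w
  rw [lengthPart_apply, sum_apply]
  simp only [gbracket_apply, lengthPart_apply]
  rw [Finset.sum_comm]
  split_ifs with h
  · refine Finset.sum_congr rfl fun i hi => ?_
    have hi' : i ≤ n := by
      have := Finset.mem_range.1 hi
      omega
    have hl : (w.take i).length = i := by simp; omega
    have hr : (w.drop i).length = n - i := by simp; omega
    rw [hl, hr, Finset.sum_sub_distrib]
    congr 1
    · rw [Finset.sum_eq_single (i, n - i)]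
      · simp
      · rintro ⟨p, q⟩ hp hne
        have : p + q = n := Finset.HasAntidiagonal.mem_antidiagonal.1 hp
        have : ¬ i = p := fun e => hne (by subst e; congr 1; omega)
        simp [this]
      · intro hne
        exact absurd (Finset.HasAntidiagonal.mem_antidiagonal.2 (by simp; omega)) hne
    · rw [Finset.sum_eq_single (n - i, i)]
      · simp
      · rintro ⟨p, q⟩ hp hne
        have : p + q = n := Finset.HasAntidiagonal.mem_antidiagonal.1 hp
        have : ¬ i = q := fun e => hne (by subst e; congr 1; omega)
        simp [this]
      · intro hne
        exact absurd (Finset.HasAntidiagonal.mem_antidiagonal.2 (by simp; omega)) hne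
  · refine (Finset.sum_eq_zero fun i hi => Finset.sum_eq_zero ?_).symm
    rintro ⟨p, q⟩ hp
    have hpq : p + q = n := Finset.HasAntidiagonal.mem_antidiagonal.1 hp
    have hi' := Finset.mem_range.1 hi
    have hl : (w.take i).length = i := by simp; omega
    have hr : (w.drop i).length = w.length - i := by simp
    rw [hl, hr]
    have h1 : ¬ (i = p ∧ w.length - i = q) := by omega
    have h2 : ¬ (i = q ∧ w.length - i = p) := by omega
    by_cases e1 : i = p <;> by_cases e2 : w.length - i = q <;>
      by_cases e3 : i = q <;> by_cases e4 : w.length - i = p <;> simp_all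

theorem gbracket_mem_completeTensor {f g : NCSeries K} (hf : f ∈ completeTensor K)
    (hg : g ∈ completeTensor K) : gbracket K f g ∈ completeTensor K := by
  obtain ⟨S, hS⟩ := hf
  obtain ⟨T, hT⟩ := hg
  refine ⟨(S ×ˢ T).image fun p => p.1 + p.2, fun w h => ?_⟩
  rw [gbracket_apply] at h
  obtain ⟨i, -, hi⟩ := Finset.exists_ne_zero_of_sum_ne_zero h
  by_cases h1 : f.coeff (w.take i) * g.coeff (w.drop i) = 0
  · rw [h1, zero_sub, neg_ne_zero] at hi
    have h2 := right_ne_zero_of_mul hi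
    refine Finset.mem_image.2 ⟨(wdeg (w.drop i), wdeg (w.take i)), ?_, ?_⟩
    · exact Finset.mem_product.2 ⟨hS _ (right_ne_zero_of_mul h2), hT _ (left_ne_zero_of_mul h2)⟩
    · exact (add_comm _ _).trans (wdeg_take_add_drop w i)
  · refine Finset.mem_image.2 ⟨(wdeg (w.take i), wdeg (w.drop i)), ?_, wdeg_take_add_drop w i⟩
    exact Finset.mem_product.2 ⟨hS _ (left_ne_zero_of_mul h1), hT _ (right_ne_zero_of_mul h1)⟩

theorem gbracket_mem_completeLie {f g : NCSeries K} (hf : f ∈ completeLie K)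
    (hg : g ∈ completeLie K) : gbracket K f g ∈ completeLie K :=
  ⟨gbracket_mem_completeTensor hf.1 hg.1, fun n => by
    rw [lengthPart_gbracket]
    exact Submodule.sum_mem _ fun p _ => gbracket_mem_freeLie (hf.2 p.1) (hg.2 p.2)⟩

theorem gen_mem_completeLie (g : Gen) : word K [g] ∈ completeLie K := by
  refine ⟨word_mem_completeTensor [g], fun n => ?_⟩
  by_cases h : n = 1
  · have : lengthPart K n (word K [g]) = word K [g] := by
      ext w
      rw [lengthPart_apply]
      split_ifs with hw
      · rfl
      · have : w ≠ [g] := by rintro rfl; simp_all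
        simp [word, this]
    rw [this]
    exact Submodule.subset_span (IsLieMonomial.gen g)
  · have : lengthPart K n (word K [g]) = 0 := by
      ext w
      rw [lengthPart_apply]
      split_ifs with hw
      · have : w ≠ [g] := by rintro rfl; simp_all
        simp [word, this]
      · rfl
    rw [this]
    exact zero_mem _

/-- The bracket of the complete free Lie algebra. -/
def lieBracket (K : Type*) [Field K] :
    completeLie K →ₗ[K] completeLie K →ₗ[K] completeLie K :=
  LinearMap.mk₂ K (fun f g => ⟨gbracket K f g, gbracket_mem_completeLie f.2 g.2⟩)
    (fun f f' g => Subtype.ext (by simp)) (fun r f g => Subtype.ext (by simp))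
    (fun f g g' => Subtype.ext (by simp)) (fun r f g => Subtype.ext (by simp))

/-- The component of degree `d` of the complete free Lie algebra. -/
def lieGrading (K : Type*) [Field K] (d : ℤ) : Submodule K (completeLie K) :=
  (homog K d).comap (completeLie K).subtype

/-- A generator as an element of the complete free Lie algebra. -/
def lgen (K : Type*) [Field K] (g : Gen) : completeLie K :=
  ⟨word K [g], gen_mem_completeLie g⟩

end NCSeries

open NCSeries

/-! ### The Lawrence-Sullivan construction -/

/-- `ad_x β + ∑_{i ≥ 0} (B_i / i!) ad_x ^ i (β - α)`. -/
def lsDiffX (K : Type*) [Field K] : NCSeries K :=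
  (lieBracket K (lgen K .x) (lgen K .β) : NCSeries K) +
    formalSum fun i => ((bernoulli i / (i.factorial : ℚ) : ℚ) : K) •
      (((lieBracket K (lgen K .x) ^ i) (lgen K .β - lgen K .α) : completeLie K) : NCSeries K)

/-- With the differential `d`, the complete free Lie algebra on `α, β, x` is a differential
graded Lie algebra in which `α` and `β` are Maurer-Cartan elements and the flow generated by `x`
moves from `α` (at time `0`) to `β` (at time `1`). -/
def IsLawrenceSullivan (K : Type*) [Field K] (d : completeLie K →ₗ[K] completeLie K) : Prop :=
  IsDGL (lieGrading K) (lieBracket K) d ∧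
  IsMaurerCartan (lieGrading K) (lieBracket K) d (lgen K .α) ∧
  IsMaurerCartan (lieGrading K) (lieBracket K) d (lgen K .β) ∧
  (formalSum fun n =>
    ((flowCoeff (lieBracket K) d (lgen K .x) (lgen K .α) n : completeLie K) : NCSeries K))
    = (lgen K .β : NCSeries K)

/-- The Lawrence-Sullivan theorem: the stated `∂x` is the unique choice that makes the complete
free Lie algebra on `α, β, x` a differential graded Lie algebra of the required kind. -/
def LawrenceSullivanTheorem (K : Type*) [Field K] : Prop :=
  (∃ d : completeLie K →ₗ[K] completeLie K,
    IsLawrenceSullivan K d ∧ (d (lgen K .x) : NCSeries K) = lsDiffX K) ∧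
  ∀ d : completeLie K →ₗ[K] completeLie K,
    IsLawrenceSullivan K d → (d (lgen K .x) : NCSeries K) = lsDiffX K

/-- `x ⊗ β - β ⊗ x + ∑_{k ≥ 0} ∑_{p + q = k} (-1)^q B_{p+q} / (p! q!) x^p ⊗ (β - α) ⊗ x^q`. -/
def tensorDiffX (K : Type*) [Field K] : NCSeries K :=
  (tgen K .x * tgen K .β - tgen K .β * tgen K .x : completeTensor K) +
    formalSum fun k => ∑ p ∈ Finset.HasAntidiagonal.antidiagonal k,
      (((-1) ^ p.2 * bernoulli (p.1 + p.2) / ((p.1.factorial : ℚ) * (p.2.factorial : ℚ)) : ℚ) : K) •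
        ((tgen K .x ^ p.1 * (tgen K .β - tgen K .α) * tgen K .x ^ p.2 : completeTensor K) :
          NCSeries K)

/-- The enveloping algebra version: with the stated values on `α, β, x`, the complete tensor
algebra is a differential graded algebra, that is, these values extend to a derivation `D` of
degree `-1` with `D ^ 2 = 0`. -/
def TensorDifferentialTheorem (K : Type*) [Field K] : Prop :=
  ∃ D : completeTensor K →ₗ[K] completeTensor K,
    IsDGA (tensorGrading K) D ∧
    D (tgen K .α) = -(tgen K .α * tgen K .α) ∧
    D (tgen K .β) = -(tgen K .β * tgen K .β) ∧
    (D (tgen K .x) : NCSeries K) = tensorDiffX K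

end

noncomputable section

open NCSeries

/-! Each of the three statements is proved outright, over any field of characteristic zero; the
equivalence is then immediate.

Existence and uniqueness of `∂x`. The flow equation is linear, so with `y = ∂x` its solution is
`u(t) = exp(-t ad_x) α + ((1 - exp(-t ad_x)) / ad_x) y`. At `t = 1` the operator applied to `y` is
the power series `(1 - exp(-T)) / T` in `ad_x`, and it has inverse `T + T / (exp T - 1)`, where the
Bernoulli numbers enter. Hence `u(1) = β` holds exactly for the Lawrence–Sullivan value of `y`
(`formalSum_flowSeq_eq_iff`). This already gives uniqueness.

`D ^ 2 = 0`. Let `D` be the graded derivation of the series algebra with the required values on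
generators. By `der_der_eq_zero` only `D ^ 2 x = 0` needs work. The curvature `c(t) = D u(t) + u(t)
^ 2` satisfies `c' = D ^ 2 x - ad_x c`, and `c(0) = c(1) = 0` because `α` and `β = u(1)` are
Maurer–Cartan. So `0 = c(1) = D ^ 2 x +` iterated brackets of `x` with `D ^ 2 x`. Those brackets
have greater word length, which forces `D ^ 2 x = 0` (`der_lsDiffX`). Restricting `D` to the
complete tensor algebra and to the complete free Lie algebra gives statements 3 and 2; their
formulas for `Dx` agree after expanding `ad_x ^ k` by the binomial theorem.

Euler-type identities. The even series `F_u = uT coth(uT/2) = 2uT / (exp(uT) - 1) + uT` generates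
the even-index Bernoulli numbers, and the addition theorem of coth is a quadratic relation between
`F_u`, `F_v` and `F_(u+v)`. With `u = x - y`, `v = y - z`, taking the coefficient of `T ^ n` for
even `n ≠ 2`, dividing by `uv` and reading off the coefficient of `x ^ a y ^ b z ^ c` gives the
identity for `(a, b, c)`. -/

instance : DecidableEq Gen := fun a b => by
  cases a <;> cases b <;> first | exact isTrue rfl | exact isFalse (fun h => by cases h)

instance : Fintype Gen where
  elems := {.α, .β, .x}
  complete g := by cases g <;> simp

namespace NCSeries

variable {K : Type*} [Field K]

/-! ### Left quotients and derivations of the algebra of series -/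

theorem mul_coeff_nil (f g : NCSeries K) : (f * g).coeff [] = f.coeff [] * g.coeff [] := by
  simp [mul_apply]

/-- The left quotient of a series by a generator. -/
def leftQuot (g : Gen) : NCSeries K →ₗ[K] NCSeries K where
  toFun f := ⟨fun w => f.coeff (g :: w)⟩
  map_add' _ _ := rfl
  map_smul' _ _ := rfl

@[simp] theorem leftQuot_coeff (g : Gen) (f : NCSeries K) (w : List Gen) :
    (leftQuot g f).coeff w = f.coeff (g :: w) := rfl

theorem leftQuot_mul (g : Gen) (f h : NCSeries K) :
    leftQuot g (f * h) = leftQuot g f * h + f.coeff [] • leftQuot g h := by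
  ext w
  simp [mul_apply, Finset.sum_range_succ' _ (w.length + 1)]

theorem word_coeff (v w : List Gen) : (word K v).coeff w = if w = v then 1 else 0 := by
  simp [word]

theorem leftQuot_one (g : Gen) : leftQuot g (1 : NCSeries K) = 0 := by
  ext w
  simp [one_apply]

theorem leftQuot_gen (g h : Gen) : leftQuot g (word K [h]) = if g = h then 1 else 0 := by
  ext w
  by_cases e : g = h <;> simp [word_coeff, e, one_apply]

theorem coeff_gen_nil (g : Gen) : (word K [g]).coeff [] = 0 := by simp [word_coeff]

theorem leftQuot_gen_mul (g h : Gen) (f : NCSeries K) :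
    leftQuot g (word K [h] * f) = if g = h then f else 0 := by
  rw [leftQuot_mul, leftQuot_gen, coeff_gen_nil, zero_smul, add_zero]
  split_ifs <;> simp

/-- Every nonempty word has a unique first letter. This decomposition drives the inductions on words
below and avoids any convergence argument. -/
theorem eq_const_add_sum_leftQuot (f : NCSeries K) :
    f = f.coeff [] • 1 + ∑ g, word K [g] * leftQuot g f := by
  ext w
  cases w with
  | nil => simp [one_apply, sum_apply, mul_coeff_nil, coeff_gen_nil]
  | cons c w =>
    rw [← leftQuot_coeff c f, ← leftQuot_coeff c (_ + _), map_add, map_smul, leftQuot_one, map_sum]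
    simp [leftQuot_gen_mul]

/-- The involution `f ↦ (-1) ^ |f| f`. -/
def gradeInv : NCSeries K →ₗ[K] NCSeries K where
  toFun f := ⟨fun w => (-1 : K) ^ wdeg w * f.coeff w⟩
  map_add' f g := by ext w; simp [mul_add]
  map_smul' r f := by ext w; simp [mul_left_comm]

theorem gradeInv_coeff (f : NCSeries K) (w : List Gen) :
    (gradeInv f).coeff w = (-1 : K) ^ wdeg w * f.coeff w := rfl

theorem gradeInv_of_homog {d : ℤ} {f : NCSeries K} (hf : f ∈ homog K d) :
    gradeInv f = (-1 : K) ^ d • f := by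
  ext w
  rw [gradeInv_coeff, smul_apply]
  by_cases h : f.coeff w = 0
  · simp [h]
  · rw [hf w h]

theorem wdeg_cons (g : Gen) (w : List Gen) : wdeg (g :: w) = g.deg + wdeg w := by simp [wdeg]

theorem leftQuot_gradeInv (g : Gen) (f : NCSeries K) :
    leftQuot g (gradeInv f) = (-1 : K) ^ g.deg • gradeInv (leftQuot g f) := by
  ext w
  rw [leftQuot_coeff, gradeInv_coeff, smul_apply, gradeInv_coeff, wdeg_cons,
    zpow_add₀ (by simp), leftQuot_coeff, mul_assoc]

/-- The coefficients of the image of a series under the derivation `der δ`. -/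
def derCoeff (δ : Gen → NCSeries K) : List Gen → NCSeries K → K
  | [], f => ∑ g, (δ g * leftQuot g f).coeff []
  -- Writing `f` as its constant term plus the sum of `g * f_g`, a derivation must send it to the
  -- sum of `δ g * f_g + (-1) ^ |g| g * D f_g`; at `c :: w` only `g = c` contributes to the second
  -- part.
  | c :: w, f => ∑ g, (δ g * leftQuot g f).coeff (c :: w) +
      (-1 : K) ^ c.deg * derCoeff δ w (leftQuot c f)

/-- The graded derivation with prescribed values on the generators. -/
def der (δ : Gen → NCSeries K) : NCSeries K →ₗ[K] NCSeries K where
  toFun f := ⟨fun w => derCoeff δ w f⟩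
  map_add' f f' := by
    ext w
    change derCoeff δ w (f + f') = derCoeff δ w f + derCoeff δ w f'
    induction w generalizing f f' with
    | nil => simp [derCoeff, mul_add, Finset.sum_add_distrib]
    | cons c w ih =>
      simp only [derCoeff, map_add, ih, mul_add, add_apply, Finset.sum_add_distrib]
      ring
  map_smul' r f := by
    ext w
    change derCoeff δ w (r • f) = r * derCoeff δ w f
    induction w generalizing f with
    | nil => simp [derCoeff, Finset.mul_sum]
    | cons c w ih =>
      simp only [derCoeff, map_smul, ih, mul_add, mul_smul_comm, smul_apply, ← Finset.mul_sum]
      ring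

variable (δ : Gen → NCSeries K)

theorem der_coeff_nil (f : NCSeries K) :
    (der δ f).coeff [] = ∑ g, (δ g).coeff [] * (leftQuot g f).coeff [] := by
  simp only [← mul_coeff_nil]
  rfl

theorem leftQuot_der (c : Gen) (f : NCSeries K) :
    leftQuot c (der δ f) = ∑ g, leftQuot c (δ g * leftQuot g f) +
      (-1 : K) ^ c.deg • der δ (leftQuot c f) := by
  ext w
  rw [add_apply, sum_apply]
  rfl

/-- The Leibniz rule for arbitrary series: `gradeInv` carries the sign, so no homogeneity is needed.
Removing the first letter reduces the coefficient at `c :: w` to coefficients at `w`. -/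
theorem der_mul (f h : NCSeries K) :
    der δ (f * h) = der δ f * h + gradeInv f * der δ h := by
  ext w
  induction w generalizing f h with
  | nil =>
    simp only [add_apply, mul_coeff_nil, der_coeff_nil, leftQuot_mul, smul_apply, Finset.sum_mul,
      Finset.mul_sum, gradeInv_coeff, ← Finset.sum_add_distrib]
    refine Finset.sum_congr rfl fun g _ => ?_
    simp only [wdeg, List.map_nil, List.sum_nil, zpow_zero]
    ring
  | cons c w ih =>
    rw [← leftQuot_coeff, ← leftQuot_coeff]
    have h1 : ∀ g, leftQuot c (δ g * leftQuot g (f * h)) =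
        leftQuot c (δ g * leftQuot g f) * h +
          ((δ g).coeff [] * (leftQuot g f).coeff []) • leftQuot c h +
          f.coeff [] • leftQuot c (δ g * leftQuot g h) := fun g => by
      rw [leftQuot_mul g, mul_add, map_add, mul_smul_comm, map_smul, ← mul_assoc,
        leftQuot_mul c (_ * _), mul_coeff_nil]
    have h2 : leftQuot c (der δ f * h + gradeInv f * der δ h) =
        (∑ g, leftQuot c (δ g * leftQuot g (f * h))) +
          (-1 : K) ^ c.deg • (der δ (leftQuot c f) * h + gradeInv (leftQuot c f) * der δ h) +
          ((-1 : K) ^ c.deg * f.coeff []) • der δ (leftQuot c h) := by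
      have h3 : (gradeInv f).coeff [] = f.coeff [] := by simp [gradeInv_coeff, wdeg]
      simp only [h1, Finset.sum_add_distrib, map_add, leftQuot_mul c (der δ f),
        leftQuot_mul c (gradeInv f), leftQuot_der, leftQuot_gradeInv, h3, der_coeff_nil,
        ← Finset.sum_smul, ← Finset.smul_sum, ← Finset.sum_mul, add_mul, smul_add, smul_mul_assoc]
      rw [smul_smul, mul_comm (f.coeff [])]
      abel
    rw [h2, leftQuot_der, leftQuot_mul c f h, map_add, map_smul]
    simp only [add_apply, smul_apply, ih]
    ring

theorem der_one : der δ (1 : NCSeries K) = 0 := by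
  have h0 : gradeInv (1 : NCSeries K) = 1 := by
    ext w
    by_cases h : w = [] <;> simp [gradeInv_coeff, one_apply, h, wdeg]
  have h := der_mul δ 1 1
  rw [mul_one, mul_one, h0, one_mul] at h
  simpa using h

theorem gen_mem_homog (g : Gen) : word K [g] ∈ homog K g.deg := fun w h => by
  have : w = [g] := by
    by_contra e
    simp [word_coeff, e] at h
  simp [this, wdeg]

theorem gradeInv_gen (g : Gen) : gradeInv (word K [g]) = (-1 : K) ^ g.deg • word K [g] :=
  gradeInv_of_homog (gen_mem_homog g)

theorem der_eq_sum (f : NCSeries K) : der δ f =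
    ∑ g, (der δ (word K [g]) * leftQuot g f +
      (-1 : K) ^ g.deg • (word K [g] * der δ (leftQuot g f))) := by
  conv_lhs => rw [eq_const_add_sum_leftQuot f, map_add, map_smul, der_one, map_sum]
  simp [der_mul, gradeInv_gen]

theorem der_gen (g : Gen) : der δ (word K [g]) = δ g := by
  ext w
  cases w with
  | nil => simp [der_coeff_nil, word_coeff]
  | cons c w =>
    rw [← leftQuot_coeff, leftQuot_der]
    have : der δ (leftQuot c (word K [g])) = 0 := by
      rw [leftQuot_gen]
      split_ifs
      · exact der_one δ
      · simp
    rw [this]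
    simp [leftQuot_gen, apply_ite]

theorem neg_one_zpow_mul_self (i : ℤ) : (-1 : K) ^ i * (-1 : K) ^ i = 1 := by
  rw [← mul_zpow]; simp

/-- The square of an odd derivation has no cross terms: the two copies of `δ g * D f_g` come with
opposite signs because `δ g` has degree `|g| - 1`. What remains passes `D ^ 2` to the left
quotients, so induction on the word applies. -/
theorem der_der_eq_zero (hδ : ∀ g, δ g ∈ homog K (g.deg - 1)) (h : ∀ g, der δ (δ g) = 0)
    (f : NCSeries K) : der δ (der δ f) = 0 := by
  have key : ∀ f, der δ (der δ f) = ∑ g, word K [g] * der δ (der δ (leftQuot g f)) := fun f => by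
    rw [der_eq_sum δ f, map_sum]
    refine Finset.sum_congr rfl fun g _ => ?_
    rw [map_add, map_smul, der_mul, der_mul, der_gen, h, gradeInv_gen, gradeInv_of_homog (hδ g),
      zpow_sub_one₀ (by simp)]
    simp only [zero_mul, zero_add, smul_add, smul_mul_assoc, smul_smul, neg_one_zpow_mul_self,
      one_smul]
    simp
  ext w
  induction w generalizing f with
  | nil => rw [key]; simp [sum_apply, mul_coeff_nil, coeff_gen_nil]
  | cons c w ih =>
    rw [← leftQuot_coeff, key, map_sum]
    simp [leftQuot_gen_mul, ih]


/-! ### The filtration by word length and locally finite sums -/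

/-- The series all of whose words have length at least `n`. -/
def lengthGE (K : Type*) [Field K] (n : ℕ) : Submodule K (NCSeries K) where
  carrier := {f | ∀ w : List Gen, w.length < n → f.coeff w = 0}
  zero_mem' _ _ := rfl
  add_mem' hf hg w hw := by rw [add_apply, hf w hw, hg w hw, add_zero]
  smul_mem' r f hf w hw := by rw [smul_apply, hf w hw, mul_zero]

theorem lengthGE_anti {m n : ℕ} (h : m ≤ n) : lengthGE K n ≤ lengthGE K m :=
  fun _ hf w hw => hf w (hw.trans_le h)

theorem mem_lengthGE_zero (f : NCSeries K) : f ∈ lengthGE K 0 := fun _ hw => absurd hw (by simp)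

theorem mul_mem_lengthGE {m n : ℕ} {f g : NCSeries K} (hf : f ∈ lengthGE K m)
    (hg : g ∈ lengthGE K n) : f * g ∈ lengthGE K (m + n) := fun w hw => by
  rw [mul_apply]
  refine Finset.sum_eq_zero fun i hi => ?_
  rw [Finset.mem_range] at hi
  by_cases h : i < m
  · rw [hf _ (by rw [List.length_take]; omega), zero_mul]
  · rw [hg _ (by rw [List.length_drop]; omega), mul_zero]

theorem mul_mem_lengthGE_left {n : ℕ} {f : NCSeries K} (hf : f ∈ lengthGE K n)
    (g : NCSeries K) : f * g ∈ lengthGE K n :=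
  mul_mem_lengthGE hf (mem_lengthGE_zero g)

theorem mul_mem_lengthGE_right {n : ℕ} (f : NCSeries K) {g : NCSeries K}
    (hg : g ∈ lengthGE K n) : f * g ∈ lengthGE K n := by
  simpa using mul_mem_lengthGE (mem_lengthGE_zero f) hg

theorem gen_mem_lengthGE (g : Gen) : word K [g] ∈ lengthGE K 1 := fun w hw => by
  have : w ≠ [g] := by rintro rfl; simp at hw
  simp [word_coeff, this]

theorem eq_zero_of_forall_mem_lengthGE {f : NCSeries K} (h : ∀ n, f ∈ lengthGE K n) : f = 0 := by
  ext w
  exact h (w.length + 1) w (Nat.lt_succ_self _)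

/-- The length filtration is separated, so identities between infinite sums can be checked on
truncations. -/
theorem eq_of_forall_sub_mem_lengthGE {f g : NCSeries K} (h : ∀ n, f - g ∈ lengthGE K n) :
    f = g := sub_eq_zero.1 (eq_zero_of_forall_mem_lengthGE h)

theorem formalSum_coeff {s : ℕ → NCSeries K} {w : List Gen} {N : ℕ}
    (h : ∀ n, N ≤ n → (s n).coeff w = 0) :
    (formalSum s).coeff w = ∑ n ∈ Finset.range N, (s n).coeff w := by
  refine finsum_eq_sum_of_support_subset _ fun n hn => ?_
  by_contra hN
  exact hn (h n (by simpa using hN))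

theorem formalSum_sub_sum_mem {s : ℕ → NCSeries K} (hs : ∀ n, s n ∈ lengthGE K n) (N : ℕ) :
    formalSum s - ∑ n ∈ Finset.range N, s n ∈ lengthGE K N := fun w hw => by
  rw [sub_apply, formalSum_coeff (N := N) fun n hn => hs n w (hw.trans_le hn), sum_apply, sub_self]

theorem formalSum_add {s t : ℕ → NCSeries K} (hs : ∀ n, s n ∈ lengthGE K n)
    (ht : ∀ n, t n ∈ lengthGE K n) :
    formalSum (fun n => s n + t n) = formalSum s + formalSum t := by
  ext w
  have h : ∀ n, w.length + 1 ≤ n → w.length < n := fun _ h => h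
  rw [add_apply, formalSum_coeff (N := w.length + 1) fun n hn => hs n w (h n hn),
    formalSum_coeff (N := w.length + 1) fun n hn => ht n w (h n hn), ← Finset.sum_add_distrib,
    formalSum_coeff (N := w.length + 1) fun n hn => (add_mem (hs n) (ht n)) w (h n hn)]
  rfl

theorem formalSum_smul (r : K) {s : ℕ → NCSeries K} (hs : ∀ n, s n ∈ lengthGE K n) :
    formalSum (fun n => r • s n) = r • formalSum s := by
  ext w
  have h : ∀ n, w.length + 1 ≤ n → w.length < n := fun _ h => h
  rw [smul_apply, formalSum_coeff (N := w.length + 1) fun n hn => hs n w (h n hn),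
    Finset.mul_sum, formalSum_coeff (N := w.length + 1) fun n hn =>
      ((lengthGE K n).smul_mem r (hs n)) w (h n hn)]
  rfl

/-- The square of indices minus the triangle `i + j < N` leaves only terms of length at least `N`: a
Cauchy product rule for truncated sums. -/
theorem sum_sum_sub_sum_antidiagonal_mem {s : ℕ → ℕ → NCSeries K}
    (hs : ∀ i j, s i j ∈ lengthGE K (i + j)) (N : ℕ) :
    ∑ i ∈ Finset.range N, ∑ j ∈ Finset.range N, s i j -
      ∑ n ∈ Finset.range N, ∑ p ∈ Finset.HasAntidiagonal.antidiagonal n, s p.1 p.2 ∈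
        lengthGE K N := by
  have h : ∑ n ∈ Finset.range N, ∑ p ∈ Finset.HasAntidiagonal.antidiagonal n, s p.1 p.2 =
      ∑ p ∈ (Finset.range N ×ˢ Finset.range N) with p.1 + p.2 < N, s p.1 p.2 := by
    rw [Finset.sum_sigma']
    refine Finset.sum_bij' (fun q _ => q.2) (fun p _ => ⟨p.1 + p.2, p⟩) ?_ ?_ ?_ ?_ ?_
    · rintro ⟨n, i, j⟩ hq
      simp only [Finset.mem_sigma, Finset.mem_range, Finset.HasAntidiagonal.mem_antidiagonal] at hq
      simp only [Finset.mem_filter, Finset.mem_product, Finset.mem_range]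
      omega
    · rintro ⟨i, j⟩ hp
      simp only [Finset.mem_filter, Finset.mem_product, Finset.mem_range] at hp
      simp only [Finset.mem_sigma, Finset.mem_range, Finset.HasAntidiagonal.mem_antidiagonal,
        and_true]
      omega
    · rintro ⟨n, i, j⟩ hq
      simp only [Finset.mem_sigma, Finset.mem_range, Finset.HasAntidiagonal.mem_antidiagonal] at hq
      obtain ⟨-, rfl⟩ := hq
      rfl
    · rintro ⟨i, j⟩ hp
      rfl
    · rintro ⟨n, i, j⟩ hq
      rfl
  rw [h, ← Finset.sum_product', ← Finset.sum_filter_add_sum_filter_not _ (fun p => p.1 + p.2 < N),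
    add_sub_cancel_left]
  refine Submodule.sum_mem _ fun p hp => ?_
  exact lengthGE_anti (not_lt.1 (Finset.mem_filter.1 hp).2) (hs p.1 p.2)

/-! ### Power series in `ad_x` -/

/-- The operator `ad_x`. -/
def adX (K : Type*) [Field K] : Module.End K (NCSeries K) :=
  LinearMap.mulLeft K (word K [.x]) - LinearMap.mulRight K (word K [.x])

theorem adX_apply (f : NCSeries K) : adX K f = word K [.x] * f - f * word K [.x] := rfl

theorem adX_mem {n : ℕ} {f : NCSeries K} (hf : f ∈ lengthGE K n) : adX K f ∈ lengthGE K (n + 1) := by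
  refine sub_mem ?_ (mul_mem_lengthGE hf (gen_mem_lengthGE _))
  rw [add_comm]
  exact mul_mem_lengthGE (gen_mem_lengthGE _) hf

theorem adX_pow_mem {n : ℕ} {f : NCSeries K} (hf : f ∈ lengthGE K n) (i : ℕ) :
    (adX K ^ i) f ∈ lengthGE K (i + n) := by
  induction i with
  | zero => simpa using hf
  | succ i ih =>
    rw [pow_succ', Module.End.mul_apply, add_right_comm]
    exact adX_mem ih

theorem smul_adX_pow_mem (r : K) (f : NCSeries K) (i : ℕ) :
    r • (adX K ^ i) f ∈ lengthGE K i :=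
  Submodule.smul_mem _ r (adX_pow_mem (mem_lengthGE_zero f) i)

/-- The power series `h(ad_x)`, applied to a series. -/
def adSeries (h : PowerSeries K) : NCSeries K →ₗ[K] NCSeries K where
  toFun f := formalSum fun i => PowerSeries.coeff i h • (adX K ^ i) f
  map_add' f g := by
    rw [← formalSum_add (fun i => smul_adX_pow_mem _ f i) fun i => smul_adX_pow_mem _ g i]
    simp
  map_smul' r f := by
    rw [RingHom.id_apply, ← formalSum_smul r fun i => smul_adX_pow_mem _ f i]
    refine congrArg formalSum (funext fun i => ?_)
    rw [map_smul, smul_comm]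

theorem adSeries_apply (h : PowerSeries K) (f : NCSeries K) :
    adSeries h f = formalSum fun i => PowerSeries.coeff i h • (adX K ^ i) f := rfl

theorem adSeries_sub_sum_mem (h : PowerSeries K) (f : NCSeries K) (N : ℕ) :
    adSeries h f - ∑ i ∈ Finset.range N, PowerSeries.coeff i h • (adX K ^ i) f ∈ lengthGE K N :=
  formalSum_sub_sum_mem (fun i => smul_adX_pow_mem _ f i) N

theorem adSeries_mem {n : ℕ} (h : PowerSeries K) {f : NCSeries K} (hf : f ∈ lengthGE K n) :
    adSeries h f ∈ lengthGE K n := fun w hw => by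
  rw [adSeries_apply, formalSum_coeff (N := 0), Finset.range_zero, Finset.sum_empty]
  intro i _
  exact Submodule.smul_mem _ _ (adX_pow_mem hf i) w (by omega)

theorem adSeries_add (h k : PowerSeries K) (f : NCSeries K) :
    adSeries (h + k) f = adSeries h f + adSeries k f := by
  simp only [adSeries_apply]
  rw [← formalSum_add (fun i => smul_adX_pow_mem _ f i) fun i => smul_adX_pow_mem _ f i]
  simp [add_smul]

/-- Together with additivity and the unit, this turns identities in `K⟦T⟧` into identities between
operators. -/
theorem adSeries_mul (h k : PowerSeries K) (f : NCSeries K) :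
    adSeries (h * k) f = adSeries h (adSeries k f) := by
  refine eq_of_forall_sub_mem_lengthGE fun N => ?_
  have h1 := adSeries_sub_sum_mem (h * k) f N
  have h2 := adSeries_sub_sum_mem h (adSeries k f) N
  have h3 : ∑ i ∈ Finset.range N, PowerSeries.coeff i h • (adX K ^ i)
      (adSeries k f - ∑ j ∈ Finset.range N, PowerSeries.coeff j k • (adX K ^ j) f) ∈
      lengthGE K N :=
    Submodule.sum_mem _ fun i _ => Submodule.smul_mem _ _
      (lengthGE_anti (Nat.le_add_left _ _) (adX_pow_mem (adSeries_sub_sum_mem k f N) i))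
  have h4 := sum_sum_sub_sum_antidiagonal_mem (K := K)
    (s := fun i j => (PowerSeries.coeff i h * PowerSeries.coeff j k) • (adX K ^ (i + j)) f)
    (fun i j => smul_adX_pow_mem _ f _) N
  have h5 : ∑ n ∈ Finset.range N, ∑ p ∈ Finset.HasAntidiagonal.antidiagonal n,
      (PowerSeries.coeff p.1 h * PowerSeries.coeff p.2 k) • (adX K ^ (p.1 + p.2)) f =
      ∑ n ∈ Finset.range N, PowerSeries.coeff n (h * k) • (adX K ^ n) f := by
    refine Finset.sum_congr rfl fun n _ => ?_
    rw [PowerSeries.coeff_mul, Finset.sum_smul]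
    refine Finset.sum_congr rfl fun p hp => ?_
    rw [Finset.HasAntidiagonal.mem_antidiagonal.1 hp]
  have h6 : ∑ i ∈ Finset.range N, ∑ j ∈ Finset.range N,
      (PowerSeries.coeff i h * PowerSeries.coeff j k) • (adX K ^ (i + j)) f =
      ∑ i ∈ Finset.range N, PowerSeries.coeff i h • (adX K ^ i)
        (∑ j ∈ Finset.range N, PowerSeries.coeff j k • (adX K ^ j) f) := by
    refine Finset.sum_congr rfl fun i _ => ?_
    rw [map_sum, Finset.smul_sum]
    refine Finset.sum_congr rfl fun j _ => ?_
    rw [map_smul, smul_smul, pow_add, Module.End.mul_apply]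
  simp only [map_sub, smul_sub, Finset.sum_sub_distrib] at h3
  rw [h5, h6] at h4
  -- Truncation errors of the product series, of the outer series, of the inner series, and of
  -- square against triangle.
  have := sub_mem (sub_mem (sub_mem h1 h2) h3) h4
  convert this using 1
  abel

theorem adSeries_one (f : NCSeries K) : adSeries 1 f = f := by
  ext w
  rw [adSeries_apply, formalSum_coeff (N := 1)]
  · simp
  · intro n hn
    simp [PowerSeries.coeff_one, show n ≠ 0 by omega]

theorem adSeries_X (f : NCSeries K) : adSeries PowerSeries.X f = adX K f := by
  ext w
  rw [adSeries_apply, formalSum_coeff (N := 2)]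
  · simp [Finset.sum_range_succ, PowerSeries.coeff_X]
  · intro n hn
    simp [PowerSeries.coeff_X, show n ≠ 1 by omega]

/-! ### The flow generated by `x` -/

section flow

variable (K)

/-- The power series `exp(-T)`. -/
def expNeg : PowerSeries K := PowerSeries.mk fun n => (-1) ^ n * (n.factorial : K)⁻¹

/-- The power series `(1 - exp(-T)) / T`. -/
def expNegQuot : PowerSeries K := PowerSeries.mk fun n => (-1) ^ n * ((n + 1).factorial : K)⁻¹

theorem X_mul_expNegQuot : PowerSeries.X * expNegQuot K = 1 - expNeg K := by
  ext n
  cases n with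
  | zero => simp [expNeg]
  | succ n =>
    rw [PowerSeries.coeff_succ_X_mul]
    simp [expNegQuot, expNeg, PowerSeries.coeff_one, pow_succ]

variable [CharZero K]

theorem exp_mul_expNeg : PowerSeries.exp K * expNeg K = 1 := by
  have : expNeg K = PowerSeries.evalNegHom (PowerSeries.exp K) := by
    ext n
    simp [expNeg, PowerSeries.evalNegHom, PowerSeries.coeff_rescale, PowerSeries.coeff_exp]
  rw [this, PowerSeries.exp_mul_exp_neg_eq_one]

theorem expNegQuot_mul_bernoulli : expNegQuot K * bernoulliPowerSeries K = expNeg K := by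
  have h1 := X_mul_expNegQuot K
  have h2 := exp_mul_expNeg K
  have h3 := bernoulliPowerSeries_mul_exp_sub_one K
  refine mul_left_cancel₀ (PowerSeries.X_ne_zero (R := K)) ?_
  linear_combination bernoulliPowerSeries K * h1 + expNeg K * h3 - bernoulliPowerSeries K * h2

/-- Since `T + T / (exp T - 1) = T / (1 - exp(-T))`, the operator applied to `y` in `u(1)` is
invertible. -/
theorem expNegQuot_mul_X_add_bernoulli :
    expNegQuot K * (PowerSeries.X + bernoulliPowerSeries K) = 1 := by
  linear_combination X_mul_expNegQuot K + expNegQuot_mul_bernoulli K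

end flow


/-! ### Graded commutators and the solution of the flow equation -/

theorem gbracket_of_homog {i j : ℤ} {f g : NCSeries K} (hf : f ∈ homog K i) (hg : g ∈ homog K j) :
    gbracket K f g = f * g - (-1 : K) ^ (i * j) • (g * f) := by
  ext w
  rw [gbracket_apply, sub_apply, smul_apply, mul_apply, mul_apply, Finset.mul_sum,
    ← Finset.sum_sub_distrib]
  refine Finset.sum_congr rfl fun k _ => ?_
  congr 1
  by_cases h1 : f.coeff (w.drop k) = 0
  · simp [h1]
  by_cases h2 : g.coeff (w.take k) = 0
  · simp [h2]
  rw [hf _ h1, hg _ h2]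

/-- As `x` has degree `0`, no sign appears, whatever the degrees occurring in `f`. -/
theorem gbracket_x (f : NCSeries K) : gbracket K (word K [.x]) f = adX K f := by
  ext w
  rw [gbracket_apply, adX_apply, sub_apply, mul_apply, mul_apply, ← Finset.sum_sub_distrib]
  refine Finset.sum_congr rfl fun k _ => ?_
  congr 1
  by_cases h1 : (word K [.x]).coeff (w.drop k) = 0
  · simp [h1]
  rw [gen_mem_homog .x _ h1]
  simp [Gen.deg]

theorem coe_lieBracket (u v : completeLie K) :
    ((lieBracket K u v : completeLie K) : NCSeries K) = gbracket K u v := rfl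

theorem coe_lgen (g : Gen) : (lgen K g : NCSeries K) = word K [g] := rfl

theorem coe_lieBracket_x_pow (i : ℕ) (u : completeLie K) :
    (((lieBracket K (lgen K .x) ^ i) u : completeLie K) : NCSeries K) = (adX K ^ i) u := by
  induction i with
  | zero => rfl
  | succ i ih =>
    rw [pow_succ', pow_succ', Module.End.mul_apply, Module.End.mul_apply, coe_lieBracket,
      coe_lgen, gbracket_x, ih]

/-- The coefficients of the solution `u(t)` of `u'(t) = y - ad_x u(t)`, `u(0) = α`. -/
def flowSeq (y : NCSeries K) : ℕ → NCSeries K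
  | 0 => word K [.α]
  | n + 1 => ((n : K) + 1)⁻¹ • ((if n = 0 then y else 0) - adX K (flowSeq y n))

theorem coe_flowCoeff (d : completeLie K →ₗ[K] completeLie K) (n : ℕ) :
    ((flowCoeff (lieBracket K) d (lgen K .x) (lgen K .α) n : completeLie K) : NCSeries K) =
      flowSeq (d (lgen K .x) : NCSeries K) n := by
  induction n with
  | zero => rfl
  | succ n ih =>
    rw [flowCoeff, flowSeq, ← ih, ← gbracket_x]
    split_ifs <;> rfl

theorem sub_gen_mem_lengthGE (g h : Gen) : word K [g] - word K [h] ∈ lengthGE K 1 :=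
  sub_mem (gen_mem_lengthGE g) (gen_mem_lengthGE h)

section CharZero

variable [CharZero K]

theorem lsDiffX_eq : lsDiffX K = adX K (word K [.β]) +
    adSeries (bernoulliPowerSeries K) (word K [.β] - word K [.α]) := by
  rw [lsDiffX, coe_lieBracket, coe_lgen, gbracket_x, adSeries_apply]
  simp only [coe_lieBracket_x_pow]
  simp [bernoulliPowerSeries, coe_lgen]

/-- The Taylor coefficients of `exp(-t ad_x) α + ((1 - exp(-t ad_x)) / ad_x) y`. The second series
starts one power of `t` later, whence the shift between the two indices. -/
theorem flowSeq_succ (y : NCSeries K) (n : ℕ) :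
    flowSeq y (n + 1) = PowerSeries.coeff (n + 1) (expNeg K) • (adX K ^ (n + 1)) (word K [.α]) +
      PowerSeries.coeff n (expNegQuot K) • (adX K ^ n) y := by
  induction n with
  | zero =>
    simp [flowSeq, expNeg, expNegQuot]
    abel
  | succ n ih =>
    have h1 : ((n : K) + 1 + 1) ≠ 0 := by exact_mod_cast Nat.succ_ne_zero (n + 1)
    rw [flowSeq, ih, if_neg (Nat.succ_ne_zero n), map_add, map_smul, map_smul,
      ← Module.End.mul_apply, ← pow_succ', ← Module.End.mul_apply, ← pow_succ', zero_sub, smul_neg,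
      smul_add, smul_smul, smul_smul, neg_add, ← neg_smul, ← neg_smul]
    simp only [expNeg, expNegQuot, PowerSeries.coeff_mk]
    rw [Nat.factorial_succ (n + 1)]
    push_cast
    rw [mul_inv, pow_succ _ (n + 1), pow_succ _ n]
    congr 2 <;> ring

theorem formalSum_flowSeq (y : NCSeries K) : formalSum (flowSeq y) =
    adSeries (expNeg K) (word K [.α]) + adSeries (expNegQuot K) y := by
  ext w
  have h : ∀ (r : K) (f : NCSeries K) (n : ℕ), w.length + 1 ≤ n →
      (r • (adX K ^ n) f).coeff w = 0 :=
    fun r f n hn => smul_adX_pow_mem r f n w hn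
  -- The `α` series is cut one term later than the `y` series, to match the index shift in
  -- `flowSeq_succ`.
  rw [add_apply, adSeries_apply, adSeries_apply,
    formalSum_coeff (N := w.length + 1 + 1) fun n hn => h _ _ n (by omega),
    formalSum_coeff (N := w.length + 1) fun n hn => h _ _ n hn,
    formalSum_coeff (N := w.length + 1 + 1), Finset.sum_range_succ' _ (w.length + 1),
    Finset.sum_range_succ' _ (w.length + 1)]
  · simp only [flowSeq_succ, add_apply, Finset.sum_add_distrib]
    simp [flowSeq, expNeg]
    ring
  · intro n hn
    obtain ⟨n, rfl⟩ : ∃ m, n = m + 1 := ⟨n - 1, by omega⟩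
    rw [flowSeq_succ, add_apply, h _ _ _ (by omega), h _ _ _ (by omega), add_zero]

/-- The endpoint condition is an invertible linear equation for `y`, so it alone determines `∂x`. -/
theorem formalSum_flowSeq_eq_iff (y : NCSeries K) :
    formalSum (flowSeq y) = word K [.β] ↔ y = lsDiffX K := by
  have hX : ∀ f : NCSeries K, adX K f = adSeries PowerSeries.X f := fun f => (adSeries_X f).symm
  have h1 := expNegQuot_mul_X_add_bernoulli K
  have h2 := expNegQuot_mul_bernoulli K
  have key : ∀ z : NCSeries K,
      adSeries (expNegQuot K) (adSeries (PowerSeries.X + bernoulliPowerSeries K) z) = z := fun z => by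
    rw [← adSeries_mul, h1, adSeries_one]
  have key' : ∀ z : NCSeries K,
      adSeries (PowerSeries.X + bernoulliPowerSeries K) (adSeries (expNegQuot K) z) = z := fun z => by
    rw [← adSeries_mul, mul_comm, h1, adSeries_one]
  have h3 : lsDiffX K = adSeries (PowerSeries.X + bernoulliPowerSeries K)
      (word K [.β] - adSeries (expNeg K) (word K [.α])) := by
    rw [lsDiffX_eq, hX, map_sub, map_sub, ← adSeries_mul _ (expNeg K), adSeries_add]
    have : (PowerSeries.X + bernoulliPowerSeries K) * expNeg K = bernoulliPowerSeries K := by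
      linear_combination bernoulliPowerSeries K * h1 -
        (PowerSeries.X + bernoulliPowerSeries K) * h2
    rw [this]
    abel
  rw [formalSum_flowSeq, h3]
  constructor
  · intro h
    rw [← h, add_sub_cancel_left, key']
  · rintro rfl
    rw [key, add_sub_cancel]

theorem lsDiffX_mem_lengthGE : lsDiffX K ∈ lengthGE K 1 := by
  rw [lsDiffX_eq]
  exact add_mem (lengthGE_anti (by norm_num) (adX_mem (gen_mem_lengthGE _)))
    (adSeries_mem _ (sub_gen_mem_lengthGE _ _))

theorem flowSeq_mem_lengthGE {y : NCSeries K} (hy : y ∈ lengthGE K 1) (n : ℕ) :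
    flowSeq y n ∈ lengthGE K n := by
  cases n with
  | zero => exact mem_lengthGE_zero _
  | succ n =>
    rw [flowSeq_succ]
    exact add_mem (smul_adX_pow_mem _ _ _) (Submodule.smul_mem _ _ (adX_pow_mem hy n))

end CharZero

/-! ### Homogeneity -/

theorem mul_mem_homog {i j : ℤ} {f g : NCSeries K} (hf : f ∈ homog K i) (hg : g ∈ homog K j) :
    f * g ∈ homog K (i + j) := fun w h => by
  rw [mul_apply] at h
  obtain ⟨k, -, hk⟩ := Finset.exists_ne_zero_of_sum_ne_zero h
  rw [← wdeg_take_add_drop w k, hf _ (left_ne_zero_of_mul hk), hg _ (right_ne_zero_of_mul hk)]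

theorem one_mem_homog : (1 : NCSeries K) ∈ homog K 0 := fun w h => by
  have : w = [] := by
    by_contra hw
    simp [one_apply, hw] at h
  simp [this, wdeg]

theorem formalSum_mem_homog {i : ℤ} {s : ℕ → NCSeries K} (hs : ∀ n, s n ∈ homog K i) :
    formalSum s ∈ homog K i := fun w h => by
  by_contra hw
  refine h ?_
  have : ∀ n, (s n).coeff w = 0 := fun n => by
    by_contra hn
    exact hw (hs n w hn)
  change ∑ᶠ n, (s n).coeff w = 0
  simp [this]

theorem adX_mem_homog {i : ℤ} {f : NCSeries K} (hf : f ∈ homog K i) : adX K f ∈ homog K i := by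
  have hx : word K [.x] ∈ homog K 0 := gen_mem_homog .x
  refine sub_mem ?_ ?_
  · simpa using mul_mem_homog hx hf
  · simpa using mul_mem_homog hf hx

theorem adX_pow_mem_homog {i : ℤ} {f : NCSeries K} (hf : f ∈ homog K i) (n : ℕ) :
    (adX K ^ n) f ∈ homog K i := by
  induction n with
  | zero => exact hf
  | succ n ih => rw [pow_succ', Module.End.mul_apply]; exact adX_mem_homog ih

theorem gen_sub_mem_homog : word K [.β] - word K [.α] ∈ homog K (-1) :=
  sub_mem (gen_mem_homog .β) (gen_mem_homog .α)

theorem lsDiffX_mem_homog [CharZero K] : lsDiffX K ∈ homog K (-1) := by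
  rw [lsDiffX_eq, adSeries_apply]
  exact add_mem (adX_mem_homog (gen_mem_homog .β)) (formalSum_mem_homog fun n =>
    Submodule.smul_mem _ _ (adX_pow_mem_homog gen_sub_mem_homog n))

theorem leftQuot_mem_homog {i : ℤ} (g : Gen) {f : NCSeries K} (hf : f ∈ homog K i) :
    leftQuot g f ∈ homog K (i - g.deg) := fun w h => by
  have := hf (g :: w) h
  rw [wdeg_cons] at this
  omega

theorem der_mem_homog {δ : Gen → NCSeries K} (hδ : ∀ g, δ g ∈ homog K (g.deg - 1)) {i : ℤ}
    {f : NCSeries K} (hf : f ∈ homog K i) : der δ f ∈ homog K (i - 1) := fun w h => by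
  induction w generalizing f i with
  | nil =>
    rw [der_coeff_nil] at h
    obtain ⟨g, -, hg⟩ := Finset.exists_ne_zero_of_sum_ne_zero h
    have h1 := hδ g _ (left_ne_zero_of_mul hg)
    have h2 := leftQuot_mem_homog g hf _ (right_ne_zero_of_mul hg)
    simp only [wdeg, List.map_nil, List.sum_nil] at *
    omega
  | cons c w ih =>
    rw [← leftQuot_coeff, leftQuot_der, add_apply, sum_apply, smul_apply] at h
    by_cases h1 : (der δ (leftQuot c f)).coeff w = 0
    · rw [h1, mul_zero, add_zero] at h
      obtain ⟨g, -, hg⟩ := Finset.exists_ne_zero_of_sum_ne_zero h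
      have := mul_mem_homog (hδ g) (leftQuot_mem_homog g hf) (c :: w) hg
      omega
    · have := ih (leftQuot_mem_homog c hf) h1
      rw [wdeg_cons]
      omega

/-- Continuity of the derivation: without constant terms in the `δ g`, it never shortens words and
so respects truncation. -/
theorem der_mem_lengthGE {δ : Gen → NCSeries K} (hδ : ∀ g, δ g ∈ lengthGE K 1) {n : ℕ}
    {f : NCSeries K} (hf : f ∈ lengthGE K n) : der δ f ∈ lengthGE K n := by
  induction n generalizing f with
  | zero => exact mem_lengthGE_zero _
  | succ n ih =>
    have hq : ∀ g, leftQuot g f ∈ lengthGE K n := fun g w hw => hf (g :: w) (by simpa using hw)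
    rw [der_eq_sum]
    refine Submodule.sum_mem _ fun g _ => ?_
    rw [der_gen, add_comm n]
    exact add_mem (mul_mem_lengthGE (hδ g) (hq g))
      (Submodule.smul_mem _ _ (mul_mem_lengthGE (gen_mem_lengthGE g) (ih (hq g))))


/-! ### The curvature of the flow and `D ^ 2 = 0` -/

/-- The coefficients of the curvature `D u(t) + u(t) ^ 2` along the flow. -/
def curvature [CharZero K] (δ : Gen → NCSeries K) (y : NCSeries K) (n : ℕ) : NCSeries K :=
  der δ (flowSeq y n) +
    ∑ p ∈ Finset.HasAntidiagonal.antidiagonal n, flowSeq y p.1 * flowSeq y p.2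

theorem flowSeq_mem_homog {y : NCSeries K} (hy : y ∈ homog K (-1)) (n : ℕ) :
    flowSeq y n ∈ homog K (-1) := by
  induction n with
  | zero => exact gen_mem_homog .α
  | succ n ih =>
    refine Submodule.smul_mem _ _ (sub_mem ?_ (adX_mem_homog ih))
    split_ifs
    · exact hy
    · exact zero_mem _

theorem adX_mul (f g : NCSeries K) : adX K (f * g) = adX K f * g + f * adX K g := by
  simp only [adX_apply]
  noncomm_ring

theorem der_adX {δ : Gen → NCSeries K} {f : NCSeries K} (hf : f ∈ homog K (-1)) :
    der δ (adX K f) = δ .x * f + f * δ .x + adX K (der δ f) := by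
  rw [adX_apply, adX_apply, map_sub, der_mul, der_mul, der_gen, gradeInv_gen, gradeInv_of_homog hf]
  simp [Gen.deg]
  abel

section CharZero

variable [CharZero K] (δ : Gen → NCSeries K)

theorem succ_smul_flowSeq (y : NCSeries K) (n : ℕ) :
    ((n : K) + 1) • flowSeq y (n + 1) = (if n = 0 then y else 0) - adX K (flowSeq y n) := by
  rw [flowSeq, smul_smul, mul_inv_cancel₀ (by exact_mod_cast Nat.succ_ne_zero n), one_smul]

/-- The coefficient form of `(u ^ 2)' = u' u + u u'` with `u' = y - ad_x u`. -/
theorem succ_smul_sum_antidiagonal (y : NCSeries K) (n : ℕ) :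
    ((n : K) + 1) • ∑ p ∈ Finset.HasAntidiagonal.antidiagonal (n + 1),
        flowSeq y p.1 * flowSeq y p.2 =
      y * flowSeq y n + flowSeq y n * y - adX K
        (∑ p ∈ Finset.HasAntidiagonal.antidiagonal n, flowSeq y p.1 * flowSeq y p.2) := by
  have h1 : ∑ p ∈ Finset.HasAntidiagonal.antidiagonal (n + 1),
      (p.1 : K) • (flowSeq y p.1 * flowSeq y p.2) =
      ∑ p ∈ Finset.HasAntidiagonal.antidiagonal n,
        ((if p.1 = 0 then y else 0) - adX K (flowSeq y p.1)) * flowSeq y p.2 := by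
    rw [Finset.Nat.sum_antidiagonal_succ]
    simp [← succ_smul_flowSeq]
  have h2 : ∑ p ∈ Finset.HasAntidiagonal.antidiagonal (n + 1),
      (p.2 : K) • (flowSeq y p.1 * flowSeq y p.2) =
      ∑ p ∈ Finset.HasAntidiagonal.antidiagonal n,
        flowSeq y p.1 * ((if p.2 = 0 then y else 0) - adX K (flowSeq y p.2)) := by
    rw [Finset.Nat.sum_antidiagonal_succ']
    simp [← succ_smul_flowSeq]
  have h3 : ∑ p ∈ Finset.HasAntidiagonal.antidiagonal n,
      (if p.1 = 0 then y else 0) * flowSeq y p.2 = y * flowSeq y n := by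
    rw [Finset.sum_eq_single (0, n)]
    · simp
    · rintro ⟨i, j⟩ hp hne
      have : i + j = n := Finset.HasAntidiagonal.mem_antidiagonal.1 hp
      have : i ≠ 0 := by rintro rfl; exact hne (by simpa using this)
      simp [this]
    · simp
  have h4 : ∑ p ∈ Finset.HasAntidiagonal.antidiagonal n,
      flowSeq y p.1 * (if p.2 = 0 then y else 0) = flowSeq y n * y := by
    rw [Finset.sum_eq_single (n, 0)]
    · simp
    · rintro ⟨i, j⟩ hp hne
      have : i + j = n := Finset.HasAntidiagonal.mem_antidiagonal.1 hp
      have : j ≠ 0 := by rintro rfl; exact hne (by simpa using this)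
      simp [this]
    · simp
  -- On this antidiagonal `n + 1 = p.1 + p.2`, so each factor is differentiated in turn.
  have h5 : ((n : K) + 1) • ∑ p ∈ Finset.HasAntidiagonal.antidiagonal (n + 1),
        flowSeq y p.1 * flowSeq y p.2 =
      ∑ p ∈ Finset.HasAntidiagonal.antidiagonal (n + 1),
        (p.1 : K) • (flowSeq y p.1 * flowSeq y p.2) +
      ∑ p ∈ Finset.HasAntidiagonal.antidiagonal (n + 1),
        (p.2 : K) • (flowSeq y p.1 * flowSeq y p.2) := by
    rw [Finset.smul_sum, ← Finset.sum_add_distrib]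
    refine Finset.sum_congr rfl fun p hp => ?_
    rw [← add_smul]
    congr 1
    exact_mod_cast (Finset.HasAntidiagonal.mem_antidiagonal.1 hp).symm
  rw [h5, h1, h2]
  simp only [sub_mul, mul_sub, Finset.sum_sub_distrib, h3, h4, map_sum, adX_mul,
    Finset.sum_add_distrib]
  abel

/-- The equation `c' = D y - ad_x c` for `y = D x`: the terms `y u + u y` from `D (ad_x u)` and from
`(u ^ 2)'` cancel. -/
theorem succ_smul_curvature (hx : δ .x ∈ homog K (-1)) (n : ℕ) :
    ((n : K) + 1) • curvature δ (δ .x) (n + 1) =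
      (if n = 0 then der δ (δ .x) else 0) - adX K (curvature δ (δ .x) n) := by
  rw [curvature, curvature, smul_add, succ_smul_sum_antidiagonal, ← map_smul, succ_smul_flowSeq,
    map_sub, der_adX (flowSeq_mem_homog hx n), map_add]
  split_ifs
  · abel
  · rw [map_zero]
    abel

/-- The values of the differential on the generators. -/
def lsGen (K : Type*) [Field K] : Gen → NCSeries K
  | .α => -(word K [.α] * word K [.α])
  | .β => -(word K [.β] * word K [.β])
  | .x => lsDiffX K

theorem lsGen_mem_lengthGE (g : Gen) : lsGen K g ∈ lengthGE K 1 := by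
  cases g
  · exact neg_mem (mul_mem_lengthGE_left (gen_mem_lengthGE _) _)
  · exact neg_mem (mul_mem_lengthGE_left (gen_mem_lengthGE _) _)
  · exact lsDiffX_mem_lengthGE

theorem lsGen_mem_homog (g : Gen) : lsGen K g ∈ homog K (g.deg - 1) := by
  cases g
  · exact neg_mem (mul_mem_homog (gen_mem_homog .α) (gen_mem_homog .α))
  · exact neg_mem (mul_mem_homog (gen_mem_homog .β) (gen_mem_homog .β))
  · exact lsDiffX_mem_homog

theorem curvature_zero : curvature (lsGen K) (lsDiffX K) 0 = 0 := by
  simp [curvature, flowSeq, der_gen, lsGen]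

/-- A truncated form of `c(1) = D β + β ^ 2 = 0`. -/
theorem sum_curvature_mem (N : ℕ) :
    ∑ n ∈ Finset.range N, curvature (lsGen K) (lsDiffX K) n ∈ lengthGE K N := by
  have hu := flowSeq_mem_lengthGE (lsDiffX_mem_lengthGE (K := K))
  have h1 := formalSum_sub_sum_mem hu N
  rw [(formalSum_flowSeq_eq_iff _).2 rfl] at h1
  set b : NCSeries K := word K [.β]
  set S := ∑ n ∈ Finset.range N, flowSeq (lsDiffX K) n with hS
  have h2 := der_mem_lengthGE (lsGen_mem_lengthGE (K := K)) h1
  have h3 := sum_sum_sub_sum_antidiagonal_mem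
    (s := fun i j => flowSeq (lsDiffX K) i * flowSeq (lsDiffX K) j)
    (fun i j => mul_mem_lengthGE (hu i) (hu j)) N
  rw [← Finset.sum_mul_sum, ← hS] at h3
  have h4 : der (lsGen K) b = -(b * b) := der_gen _ _
  rw [map_sub, h4] at h2
  -- Up to sign this is `b ^ 2 - S ^ 2 = b (b - S) + (b - S) S`.
  have h5 := add_mem (mul_mem_lengthGE_right b h1) (mul_mem_lengthGE_left h1 S)
  have h6 := neg_mem (add_mem (add_mem h2 h3) h5)
  simp only [curvature, Finset.sum_add_distrib, ← map_sum]
  convert h6 using 1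
  rw [← hS]
  noncomm_ring

theorem der_lsDiffX : der (lsGen K) (lsDiffX K) = 0 := by
  refine eq_zero_of_forall_mem_lengthGE fun M => ?_
  induction M with
  | zero => exact mem_lengthGE_zero _
  | succ M ih =>
    have hs := succ_smul_curvature (lsGen K) lsDiffX_mem_homog
    change ∀ n : ℕ, ((n : K) + 1) • curvature (lsGen K) (lsDiffX K) (n + 1) =
      (if n = 0 then der (lsGen K) (lsDiffX K) else 0) -
        adX K (curvature (lsGen K) (lsDiffX K) n) at hs
    have h1 : curvature (lsGen K) (lsDiffX K) 1 = der (lsGen K) (lsDiffX K) := by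
      simpa [curvature_zero] using hs 0
    -- Each later coefficient is a multiple of `ad_x` of the previous one, hence longer by one
    -- letter.
    have hn : ∀ n, curvature (lsGen K) (lsDiffX K) (n + 1) ∈ lengthGE K (M + n) := fun n => by
      induction n with
      | zero => rw [h1]; exact ih
      | succ n ihn =>
        have h0 : ((n + 1 : ℕ) : K) + 1 ≠ 0 := by exact_mod_cast Nat.succ_ne_zero (n + 1)
        refine ((lengthGE K _).smul_mem_iff h0).1 ?_
        rw [hs, if_neg (Nat.succ_ne_zero n), zero_sub]
        exact neg_mem (adX_mem ihn)
    -- With `M + 2` terms, `c_0 = 0` and `c_1 = D ^ 2 x` split off even when `M = 0`; the others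
    -- have length at least `M + 1`.
    have hsum := lengthGE_anti (Nat.le_succ _) (sum_curvature_mem (K := K) (M + 2))
    rw [Finset.sum_range_succ', Finset.sum_range_succ', curvature_zero, add_zero, zero_add, h1]
      at hsum
    have hrest : ∑ k ∈ Finset.range M, curvature (lsGen K) (lsDiffX K) (k + 1 + 1) ∈
        lengthGE K (M + 1) :=
      Submodule.sum_mem _ fun k _ => lengthGE_anti (by omega) (hn (k + 1))
    simpa using sub_mem hsum hrest

theorem der_lsGen (g : Gen) : der (lsGen K) (lsGen K g) = 0 := by
  have h : ∀ g : Gen, g.deg = -1 → der (lsGen K) (word K [g]) = -(word K [g] * word K [g]) →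
      der (lsGen K) (-(word K [g] * word K [g])) = 0 := fun g hd hg => by
    rw [map_neg, der_mul, hg, gradeInv_gen, hd]
    simp [mul_assoc]
  cases g
  · exact h .α rfl (der_gen _ _)
  · exact h .β rfl (der_gen _ _)
  · exact der_lsDiffX

theorem der_lsGen_sq (f : NCSeries K) : der (lsGen K) (der (lsGen K) f) = 0 :=
  der_der_eq_zero _ lsGen_mem_homog der_lsGen f

end CharZero


/-! ### The gradings -/

/-- The homogeneous component of degree `d` of a series. -/
def homogPart (d : ℤ) : NCSeries K →ₗ[K] NCSeries K where
  toFun f := ⟨fun w => if wdeg w = d then f.coeff w else 0⟩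
  map_add' f g := by ext w; by_cases h : wdeg w = d <;> simp [h]
  map_smul' r f := by ext w; by_cases h : wdeg w = d <;> simp [h]

theorem homogPart_coeff (d : ℤ) (f : NCSeries K) (w : List Gen) :
    (homogPart d f).coeff w = if wdeg w = d then f.coeff w else 0 := rfl

theorem homogPart_mem_homog (d : ℤ) (f : NCSeries K) : homogPart d f ∈ homog K d := fun w h => by
  by_contra hw
  simp [homogPart_coeff, hw] at h

theorem homogPart_of_homog (d : ℤ) {e : ℤ} {f : NCSeries K} (hf : f ∈ homog K e) :
    homogPart d f = if e = d then f else 0 := by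
  ext w
  by_cases h : f.coeff w = 0
  · split_ifs <;> simp [homogPart_coeff, h]
  · have := hf w h
    subst this
    by_cases hd : wdeg w = d <;> simp [homogPart_coeff, hd]

theorem homog_le_completeTensor {d : ℤ} {f : NCSeries K} (hf : f ∈ homog K d) :
    f ∈ completeTensor K := ⟨{d}, fun w h => Finset.mem_singleton.2 (hf w h)⟩

theorem exists_eq_sum_homogPart {f : NCSeries K} (hf : f ∈ completeTensor K) :
    ∃ S : Finset ℤ, f = ∑ d ∈ S, homogPart d f := by
  obtain ⟨S, hS⟩ := hf
  refine ⟨S, ?_⟩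
  ext w
  rw [sum_apply]
  simp only [homogPart_coeff, Finset.sum_ite_eq]
  split_ifs with h
  · rfl
  · by_contra h0
    exact h (hS w h0)

/-- One argument for both the tensor and the Lie completion: finitely many degrees occur in each
element, and `W` contains its homogeneous parts. -/
theorem isInternal_comap_homog (W : Submodule K (NCSeries K))
    (hW : ∀ f ∈ W, f ∈ completeTensor K) (hp : ∀ (d : ℤ), ∀ f ∈ W, homogPart d f ∈ W) :
    DirectSum.IsInternal fun d : ℤ => (homog K d).comap W.subtype := by
  constructor
  · refine (injective_iff_map_eq_zero _).2 fun x hx => ?_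
    -- A coefficient of the total sum sees only the component of that word's degree; this yields
    -- injectivity.
    have key : ∀ (x : DirectSum ℤ fun d : ℤ => ((homog K d).comap W.subtype : Submodule K W))
        (w : List Gen), (DirectSum.coeAddMonoidHom (fun d : ℤ => (homog K d).comap W.subtype) x :
          NCSeries K).coeff w = ((x (wdeg w) : W) : NCSeries K).coeff w := fun x w => by
      induction x using DirectSum.induction_on with
      | zero => simp
      | of i u =>
        rw [DirectSum.coeAddMonoidHom_of]
        by_cases h : i = wdeg w
        · subst h
          rw [DirectSum.of_eq_same]
        · rw [DirectSum.of_eq_of_ne _ _ _ (Ne.symm h)]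
          by_contra h0
          exact h (u.2 w h0).symm
      | add x y hx hy =>
        rw [map_add, DirectSum.add_apply]
        exact congrArg₂ (· + ·) hx hy
    refine DFinsupp.ext fun d => Subtype.ext (Subtype.ext (NCSeries.ext fun w => ?_))
    by_cases h : d = wdeg w
    · subst h
      refine (key x w).symm.trans ?_
      rw [hx]
      rfl
    · by_contra h0
      exact h ((x d).2 w h0).symm
  · intro f
    obtain ⟨S, hS⟩ := exists_eq_sum_homogPart (hW f f.2)
    refine ⟨∑ d ∈ S, DirectSum.of (fun d : ℤ => ((homog K d).comap W.subtype : Submodule K W)) d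
      ⟨⟨homogPart d f, hp d f f.2⟩, homogPart_mem_homog d _⟩, ?_⟩
    rw [map_sum]
    simp only [DirectSum.coeAddMonoidHom_of]
    refine Subtype.ext ?_
    rw [AddSubmonoidClass.coe_finsetSum]
    exact hS.symm

theorem homogPart_mem_completeTensor (d : ℤ) (f : NCSeries K) : homogPart d f ∈ completeTensor K :=
  homog_le_completeTensor (homogPart_mem_homog d f)

theorem tensorGrading_isInternal : DirectSum.IsInternal (tensorGrading K) :=
  isInternal_comap_homog (Subalgebra.toSubmodule (completeTensor K)) (fun _ hf => hf)
    fun d f _ => homogPart_mem_completeTensor d f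

theorem neg_one_zpow_eq_ite (i : ℤ) : (-1 : K) ^ i = if Even i then 1 else -1 := by
  split_ifs with h
  · exact h.neg_one_zpow
  · exact (Int.not_even_iff_odd.1 h).neg_one_zpow

theorem gbracket_mem_homog {i j : ℤ} {f g : NCSeries K} (hf : f ∈ homog K i)
    (hg : g ∈ homog K j) : gbracket K f g ∈ homog K (i + j) := by
  rw [gbracket_of_homog hf hg]
  refine sub_mem (mul_mem_homog hf hg) (Submodule.smul_mem _ _ ?_)
  rw [add_comm]
  exact mul_mem_homog hg hf

theorem IsLieMonomial.exists_mem_homog {f : NCSeries K} (hf : IsLieMonomial K f) :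
    ∃ d, f ∈ homog K d := by
  induction hf with
  | gen g => exact ⟨_, gen_mem_homog g⟩
  | bracket _ _ hu hv =>
    obtain ⟨i, hi⟩ := hu
    obtain ⟨j, hj⟩ := hv
    exact ⟨_, gbracket_mem_homog hi hj⟩

theorem homogPart_mem_freeLie (d : ℤ) {f : NCSeries K} (hf : f ∈ freeLie K) :
    homogPart d f ∈ freeLie K := by
  induction hf using Submodule.span_induction with
  | mem u hu =>
    obtain ⟨e, he⟩ := IsLieMonomial.exists_mem_homog hu
    rw [homogPart_of_homog d he]
    split_ifs
    · exact Submodule.subset_span hu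
    · exact zero_mem _
  | zero => simp
  | add u v _ _ h h' => rw [map_add]; exact add_mem h h'
  | smul r u _ h => rw [map_smul]; exact Submodule.smul_mem _ r h

theorem lengthPart_homogPart (n : ℕ) (d : ℤ) (f : NCSeries K) :
    lengthPart K n (homogPart d f) = homogPart d (lengthPart K n f) := by
  ext w
  by_cases h : w.length = n <;> simp [homogPart_coeff, lengthPart_apply, h]

theorem lieGrading_isInternal : DirectSum.IsInternal (lieGrading K) :=
  isInternal_comap_homog (completeLie K) (fun _ hf => hf.1) fun d f hf =>
    ⟨homogPart_mem_completeTensor d f, fun n => by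
      rw [lengthPart_homogPart]; exact homogPart_mem_freeLie d (hf.2 n)⟩

/-! ### The graded Lie algebra structure -/

theorem gbracket_antisymm {i j : ℤ} {f g : NCSeries K} (hf : f ∈ homog K i)
    (hg : g ∈ homog K j) : gbracket K f g = (-1 : K) ^ (i * j + 1) • gbracket K g f := by
  rw [gbracket_of_homog hf hg, gbracket_of_homog hg hf]
  simp only [neg_one_zpow_eq_ite, Int.even_mul, Int.even_add_one]
  by_cases hi : Even i <;> by_cases hj : Even j <;> simp [hi, hj, add_comm]

theorem gbracket_jacobi {i j k : ℤ} {f g h : NCSeries K} (hf : f ∈ homog K i)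
    (hg : g ∈ homog K j) (hh : h ∈ homog K k) :
    gbracket K f (gbracket K g h) = gbracket K (gbracket K f g) h +
      (-1 : K) ^ (i * j) • gbracket K g (gbracket K f h) := by
  rw [gbracket_of_homog hf (gbracket_mem_homog hg hh), gbracket_of_homog hg hh,
    gbracket_of_homog (gbracket_mem_homog hf hg) hh, gbracket_of_homog hf hg,
    gbracket_of_homog hg (gbracket_mem_homog hf hh), gbracket_of_homog hf hh]
  simp only [neg_one_zpow_eq_ite, Int.even_mul, Int.even_add]
  by_cases hi : Even i <;> by_cases hj : Even j <;> by_cases hk : Even k <;>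
    simp [hi, hj, hk] <;> noncomm_ring

theorem der_gbracket {δ : Gen → NCSeries K} (hδ : ∀ g, δ g ∈ homog K (g.deg - 1)) {i j : ℤ}
    {f g : NCSeries K} (hf : f ∈ homog K i) (hg : g ∈ homog K j) :
    der δ (gbracket K f g) = gbracket K (der δ f) g + (-1 : K) ^ i • gbracket K f (der δ g) := by
  rw [gbracket_of_homog hf hg, gbracket_of_homog (der_mem_homog hδ hf) hg,
    gbracket_of_homog hf (der_mem_homog hδ hg), map_sub, map_smul, der_mul, der_mul,
    gradeInv_of_homog hf, gradeInv_of_homog hg]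
  simp only [neg_one_zpow_eq_ite, Int.even_mul, Int.even_sub_one]
  by_cases hi : Even i <;> by_cases hj : Even j <;> simp [hi, hj] <;> abel

/-! ### Restricting the derivation -/

theorem der_mem_completeTensor {δ : Gen → NCSeries K} (hδ : ∀ g, δ g ∈ homog K (g.deg - 1))
    {f : NCSeries K} (hf : f ∈ completeTensor K) : der δ f ∈ completeTensor K := by
  obtain ⟨S, hS⟩ := exists_eq_sum_homogPart hf
  rw [hS, map_sum]
  exact sum_mem fun d _ => homog_le_completeTensor (der_mem_homog hδ (homogPart_mem_homog d f))

theorem lengthPart_eq_of_sub_mem {n : ℕ} {f g : NCSeries K} (h : f - g ∈ lengthGE K (n + 1)) :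
    lengthPart K n f = lengthPart K n g := by
  rw [← sub_eq_zero, ← map_sub]
  ext w
  rw [lengthPart_apply]
  split_ifs with hw
  · exact h w (by omega)
  · rfl

theorem sub_sum_lengthPart_mem (f : NCSeries K) (N : ℕ) :
    f - ∑ n ∈ Finset.range N, lengthPart K n f ∈ lengthGE K N := fun w hw => by
  simp [sum_apply, lengthPart_apply, hw]

theorem freeLie_le_completeLie : freeLie K ≤ completeLie K := by
  refine Submodule.span_le.2 fun f hf => ?_
  induction hf with
  | gen g => exact gen_mem_completeLie g
  | bracket _ _ hu hv => exact gbracket_mem_completeLie hu hv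

theorem der_mem_completeLie_of_freeLie {δ : Gen → NCSeries K}
    (hδ : ∀ g, δ g ∈ homog K (g.deg - 1)) (hL : ∀ g, δ g ∈ completeLie K) {f : NCSeries K}
    (hf : f ∈ freeLie K) : der δ f ∈ completeLie K := by
  induction hf using Submodule.span_induction with
  | mem u hu =>
    induction hu with
    | gen g => rw [der_gen]; exact hL g
    | bracket hu hv hu' hv' =>
      obtain ⟨i, hi⟩ := IsLieMonomial.exists_mem_homog hu
      obtain ⟨j, hj⟩ := IsLieMonomial.exists_mem_homog hv
      rw [der_gbracket hδ hi hj]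
      exact add_mem
        (gbracket_mem_completeLie hu' (freeLie_le_completeLie (Submodule.subset_span hv)))
        (Submodule.smul_mem _ _
          (gbracket_mem_completeLie (freeLie_le_completeLie (Submodule.subset_span hu)) hv'))
  | zero => simp
  | add u v _ _ h h' => rw [map_add]; exact add_mem h h'
  | smul r u _ h => rw [map_smul]; exact Submodule.smul_mem _ r h

/-- Each length component of the image depends only on a finite truncation of `f`, which lies in the
uncompleted free Lie algebra. -/
theorem der_mem_completeLie {δ : Gen → NCSeries K} (h1 : ∀ g, δ g ∈ lengthGE K 1)
    (hδ : ∀ g, δ g ∈ homog K (g.deg - 1)) (hL : ∀ g, δ g ∈ completeLie K) {f : NCSeries K}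
    (hf : f ∈ completeLie K) : der δ f ∈ completeLie K := by
  refine ⟨der_mem_completeTensor hδ hf.1, fun n => ?_⟩
  have h := der_mem_lengthGE h1 (sub_sum_lengthPart_mem f (n + 1))
  rw [map_sub] at h
  rw [lengthPart_eq_of_sub_mem h, map_sum, map_sum]
  exact sum_mem fun m _ => (der_mem_completeLie_of_freeLie hδ hL (hf.2 m)).2 n

theorem adX_mem_completeLie {f : NCSeries K} (hf : f ∈ completeLie K) :
    adX K f ∈ completeLie K := by
  rw [← gbracket_x]
  exact gbracket_mem_completeLie (gen_mem_completeLie _) hf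

theorem adX_pow_mem_completeLie {f : NCSeries K} (hf : f ∈ completeLie K) (i : ℕ) :
    (adX K ^ i) f ∈ completeLie K := by
  induction i with
  | zero => exact hf
  | succ i ih => rw [pow_succ', Module.End.mul_apply]; exact adX_mem_completeLie ih

theorem gbracket_self_of_odd {g : NCSeries K} (hg : g ∈ homog K (-1)) :
    gbracket K g g = (2 : K) • (g * g) := by
  rw [gbracket_of_homog hg hg]
  simp [two_smul]

/-- Left and right multiplication by `x` commute, so the binomial theorem applies to their
difference. -/
theorem adX_pow_apply (f : NCSeries K) (k : ℕ) : (adX K ^ k) f =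
    ∑ p ∈ Finset.HasAntidiagonal.antidiagonal k,
      ((k.choose p.1 : K) * (-1) ^ p.2) • (word K [.x] ^ p.1 * f * word K [.x] ^ p.2) := by
  have hc : Commute (LinearMap.mulLeft K (word K [.x])) (-LinearMap.mulRight K (word K [.x])) :=
    (LinearMap.commute_mulLeft_right _ _).neg_right
  rw [adX, sub_eq_add_neg, hc.add_pow', LinearMap.sum_apply]
  refine Finset.sum_congr rfl fun p _ => ?_
  rw [neg_pow, LinearMap.pow_mulLeft, LinearMap.pow_mulRight]
  have h : ∀ (q : ℕ) (T : Module.End K (NCSeries K)), (-1) ^ q * T = (-1 : K) ^ q • T :=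
    fun q T => by
      rcases Nat.even_or_odd q with h | h <;> simp [h.neg_one_pow]
  rw [h, mul_smul_comm, LinearMap.smul_apply, LinearMap.smul_apply, mul_smul, Nat.cast_smul_eq_nsmul]
  simp [mul_assoc]

/-! ### The differentials on the two completions -/

section CharZero

variable [CharZero K]

theorem lsDiffX_mem_completeLie : lsDiffX K ∈ completeLie K := by
  refine ⟨homog_le_completeTensor lsDiffX_mem_homog, fun n => ?_⟩
  rw [lsDiffX_eq, map_add, lengthPart_eq_of_sub_mem (adSeries_sub_sum_mem _ _ _), map_sum]
  refine add_mem ((adX_mem_completeLie (gen_mem_completeLie _)).2 n) (sum_mem fun i _ => ?_)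
  exact (Submodule.smul_mem _ _ (adX_pow_mem_completeLie
    (sub_mem (gen_mem_completeLie _) (gen_mem_completeLie _)) i)).2 n

theorem mul_self_mem_completeLie {g : NCSeries K} (hg : g ∈ homog K (-1))
    (hL : g ∈ completeLie K) : g * g ∈ completeLie K := by
  have : g * g = (2⁻¹ : K) • gbracket K g g := by
    rw [gbracket_self_of_odd hg, smul_smul, inv_mul_cancel₀ two_ne_zero, one_smul]
  rw [this]
  exact Submodule.smul_mem _ _ (gbracket_mem_completeLie hL hL)

theorem lsGen_mem_completeLie (g : Gen) : lsGen K g ∈ completeLie K := by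
  cases g
  · exact neg_mem (mul_self_mem_completeLie (gen_mem_homog .α) (gen_mem_completeLie _))
  · exact neg_mem (mul_self_mem_completeLie (gen_mem_homog .β) (gen_mem_completeLie _))
  · exact lsDiffX_mem_completeLie

variable (K)

/-- The differential of the complete tensor algebra. -/
def tensorDiff : completeTensor K →ₗ[K] completeTensor K where
  toFun f := ⟨der (lsGen K) f, der_mem_completeTensor lsGen_mem_homog f.2⟩
  map_add' _ _ := Subtype.ext (map_add _ _ _)
  map_smul' r _ := Subtype.ext (map_smul (der (lsGen K)) r _)

/-- The differential of the complete free Lie algebra. -/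
def lieDiff : completeLie K →ₗ[K] completeLie K :=
  (der (lsGen K)).restrict fun _ hf =>
    der_mem_completeLie lsGen_mem_lengthGE lsGen_mem_homog lsGen_mem_completeLie hf

theorem isDGA_tensorDiff : IsDGA (tensorGrading K) (tensorDiff K) where
  internal := tensorGrading_isInternal
  one_mem := one_mem_homog
  mul_mem _ _ _ _ hu hv := mul_mem_homog hu hv
  diff_mem _ _ hu := der_mem_homog lsGen_mem_homog hu
  leibniz i j u v hu hv := Subtype.ext <| by
    have hu' : (u : NCSeries K) ∈ homog K i := hu
    change der (lsGen K) ((u : NCSeries K) * v) = der (lsGen K) u * v +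
      (-1 : K) ^ i • ((u : NCSeries K) * der (lsGen K) v)
    rw [der_mul, gradeInv_of_homog hu', smul_mul_assoc]
  sq_zero u := Subtype.ext (der_lsGen_sq _)

theorem isDGL_lieDiff : IsDGL (lieGrading K) (lieBracket K) (lieDiff K) where
  internal := lieGrading_isInternal
  bracket_mem _ _ _ _ hu hv := gbracket_mem_homog hu hv
  antisymm _ _ _ _ hu hv := Subtype.ext (gbracket_antisymm hu hv)
  jacobi _ _ _ _ _ _ hu hv hw := Subtype.ext (gbracket_jacobi hu hv hw)
  diff_mem _ _ hu := der_mem_homog lsGen_mem_homog hu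
  leibniz _ _ _ _ hu hv := Subtype.ext (der_gbracket lsGen_mem_homog hu hv)
  sq_zero _ := Subtype.ext (der_lsGen_sq _)

theorem flow_eq_iff (d : completeLie K →ₗ[K] completeLie K) :
    (formalSum fun n =>
      ((flowCoeff (lieBracket K) d (lgen K .x) (lgen K .α) n : completeLie K) : NCSeries K))
      = (lgen K .β : NCSeries K) ↔ (d (lgen K .x) : NCSeries K) = lsDiffX K := by
  simp only [coe_flowCoeff]
  exact formalSum_flowSeq_eq_iff _

theorem isMaurerCartan_lieDiff {g : Gen} (hd : g.deg = -1)
    (hg : lsGen K g = -(word K [g] * word K [g])) :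
    IsMaurerCartan (lieGrading K) (lieBracket K) (lieDiff K) (lgen K g) := by
  have hh : word K [g] ∈ homog K (-1) := hd ▸ gen_mem_homog g
  refine ⟨hh, Subtype.ext ?_⟩
  change der (lsGen K) (word K [g]) + (2⁻¹ : K) • gbracket K (word K [g]) (word K [g]) = 0
  rw [der_gen, hg, gbracket_self_of_odd hh, smul_smul, inv_mul_cancel₀ two_ne_zero, one_smul,
    neg_add_cancel]

theorem lieDiff_x : (lieDiff K (lgen K .x) : NCSeries K) = lsDiffX K := der_gen _ _

/-- The Lawrence-Sullivan theorem holds. -/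
theorem lawrenceSullivanTheorem : LawrenceSullivanTheorem K :=
  ⟨⟨lieDiff K, ⟨isDGL_lieDiff K, isMaurerCartan_lieDiff K rfl rfl,
    isMaurerCartan_lieDiff K rfl rfl, (flow_eq_iff K _).2 (lieDiff_x K)⟩, lieDiff_x K⟩,
    fun d hd => (flow_eq_iff K d).1 hd.2.2.2⟩

variable {K}

theorem tensorDiffX_eq_lsDiffX : tensorDiffX K = lsDiffX K := by
  rw [lsDiffX_eq, tensorDiffX, adSeries_apply]
  refine congrArg₂ (· + ·) rfl (congrArg formalSum (funext fun k => ?_))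
  rw [adX_pow_apply, Finset.smul_sum]
  refine Finset.sum_congr rfl fun p hp => ?_
  obtain rfl := Finset.HasAntidiagonal.mem_antidiagonal.1 hp
  rw [smul_smul]
  refine congrArg₂ (· • ·) ?_ rfl
  have h1 : ((p.1.factorial : ℕ) : K) ≠ 0 := by exact_mod_cast p.1.factorial_ne_zero
  have h2 : ((p.2.factorial : ℕ) : K) ≠ 0 := by exact_mod_cast p.2.factorial_ne_zero
  have h3 : (((p.1 + p.2).factorial : ℕ) : K) ≠ 0 := by
    exact_mod_cast (p.1 + p.2).factorial_ne_zero
  have h4 : ((p.1 + p.2).choose p.1 : K) * p.1.factorial * p.2.factorial =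
      (p.1 + p.2).factorial := by
    rw [Nat.choose_symm_add]
    exact_mod_cast Nat.add_choose_mul_factorial_mul_factorial p.1 p.2
  simp only [bernoulliPowerSeries, PowerSeries.coeff_mk, eq_ratCast]
  push_cast
  rw [← h4] at h3 ⊢
  have h5 : ((p.1 + p.2).choose p.1 : K) ≠ 0 := left_ne_zero_of_mul (left_ne_zero_of_mul h3)
  field_simp

variable (K)

/-- The enveloping algebra version of the Lawrence-Sullivan theorem holds. -/
theorem tensorDifferentialTheorem : TensorDifferentialTheorem K :=
  ⟨tensorDiff K, isDGA_tensorDiff K, Subtype.ext (der_gen _ _), Subtype.ext (der_gen _ _), by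
    rw [tensorDiffX_eq_lsDiffX]; exact der_gen _ _⟩

end CharZero

end NCSeries

/-! ### The Euler-type identities -/

namespace EulerTypeIdentities

/-- The power series `2 (T / (exp T - 1)) + T`. -/
def series (R : Type*) [CommRing R] [Algebra ℚ R] (u : R) : PowerSeries R :=
  2 * PowerSeries.rescale u (bernoulliPowerSeries R) + PowerSeries.C u * PowerSeries.X

/-- The coefficients of `2 (T / (exp T - 1)) + T`. -/
def seriesCoeff (n : ℕ) : ℚ := 2 * (bernoulli n / n.factorial) + if n = 1 then 1 else 0

/-- The series is `T coth(T/2)`, which is even: the added `T` cancels the contribution of `B_1`. -/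
theorem seriesCoeff_of_odd {n : ℕ} (h : Odd n) : seriesCoeff n = 0 := by
  by_cases h1 : n = 1
  · subst h1
    norm_num [seriesCoeff]
  · have : 1 < n := by
      obtain ⟨k, rfl⟩ := h
      omega
    simp [seriesCoeff, h1, bernoulli_eq_zero_of_odd h this]

section CommRing

variable {R : Type*} [CommRing R]

/-- The polynomial `(x - y) ^ k ((x - z) ^ m - (y - z) ^ m) / (x - y)`. -/
def dividedDiff (k m : ℕ) (x y z : R) : R :=
  (x - y) ^ k * ∑ c ∈ Finset.range (m + 1), (m.choose c : R) * (-z) ^ c *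
    ∑ i ∈ Finset.range (m - c), x ^ i * y ^ (m - c - 1 - i)

theorem dividedDiff_mul (k m : ℕ) (x y z : R) :
    dividedDiff k m x y z * (x - y) = (x - y) ^ k * ((x - z) ^ m - (y - z) ^ m) := by
  rw [dividedDiff, mul_assoc, Finset.sum_mul, sub_eq_add_neg x z, sub_eq_add_neg y z,
    add_comm x (-z), add_comm y (-z), add_pow, add_pow, ← Finset.sum_sub_distrib]
  congr 1
  refine Finset.sum_congr rfl fun c _ => ?_
  rw [mul_assoc, geom_sum₂_mul]
  ring

/-! ### The addition theorem and its coefficients -/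

variable [Algebra ℚ R]

theorem coeff_series (u : R) (n : ℕ) :
    PowerSeries.coeff n (series R u) = seriesCoeff n • u ^ n := by
  have h2 : (2 : PowerSeries R) = PowerSeries.C (2 : R) := (map_ofNat PowerSeries.C 2).symm
  rw [series, map_add, h2, PowerSeries.coeff_C_mul, PowerSeries.coeff_rescale,
    PowerSeries.coeff_C_mul, PowerSeries.coeff_X, seriesCoeff, add_smul, Algebra.smul_def,
    bernoulliPowerSeries, PowerSeries.coeff_mk, map_mul, map_ofNat]
  congr 1
  · ring
  · split_ifs with h <;> simp [h]

theorem series_mul (u : R) : series R u * (PowerSeries.rescale u (PowerSeries.exp R) - 1) =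
    PowerSeries.C u * PowerSeries.X * (PowerSeries.rescale u (PowerSeries.exp R) + 1) := by
  have h := congrArg (PowerSeries.rescale u) (bernoulliPowerSeries_mul_exp_sub_one R)
  rw [map_mul, map_sub, map_one, PowerSeries.rescale_X] at h
  rw [series]
  linear_combination 2 * h

theorem rescale_exp_sub_one_ne_zero {u : R} (hu : u ≠ 0) :
    PowerSeries.rescale u (PowerSeries.exp R) - 1 ≠ 0 := fun h => hu <| by
  simpa [PowerSeries.coeff_one, PowerSeries.coeff_exp] using congrArg (PowerSeries.coeff 1) h

/-- The addition theorem of the hyperbolic cotangent. -/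
theorem series_addition [IsDomain R] {u v : R} (hu : u ≠ 0) (hv : v ≠ 0) (huv : u + v ≠ 0) :
    PowerSeries.C v * (series R u * series R (u + v) - series R u * series R v) -
      PowerSeries.C u * (series R v * series R u - series R v * series R (u + v)) =
      PowerSeries.C (u * v * (u + v)) * PowerSeries.X ^ 2 := by
  have h1 := series_mul u
  have h2 := series_mul v
  have h3 := series_mul (u + v)
  have ha := PowerSeries.exp_mul_exp_eq_exp_add u v
  have n1 := rescale_exp_sub_one_ne_zero hu
  have n2 := rescale_exp_sub_one_ne_zero hv
  have n3 := rescale_exp_sub_one_ne_zero huv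
  rw [← ha] at h3 n3
  simp only [map_add, map_mul] at h3 ⊢
  set p := PowerSeries.rescale u (PowerSeries.exp R)
  set q := PowerSeries.rescale v (PowerSeries.exp R)
  set F := series R u
  set G := series R v
  set H := series R (u + v)
  set U := PowerSeries.C u
  set V := PowerSeries.C v
  set T : PowerSeries R := PowerSeries.X
  -- Clearing the denominators `exp(uT) - 1`, `exp(vT) - 1`, `exp((u+v)T) - 1` leaves a polynomial
  -- identity.
  refine mul_right_cancel₀ (mul_ne_zero (mul_ne_zero n1 n2) n3) ?_
  have e1 : (V * (F * H - F * G) - U * (G * F - G * H)) * ((p - 1) * (q - 1) * (p * q - 1)) =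
      V * (F * (p - 1)) * (H * (p * q - 1)) * (q - 1) +
      U * (G * (q - 1)) * (H * (p * q - 1)) * (p - 1) -
      (U + V) * (F * (p - 1)) * (G * (q - 1)) * (p * q - 1) := by ring
  rw [e1, h1, h2, h3]
  ring

theorem sum_seriesCoeff_eq_zero [IsDomain R] {u v : R} (hu : u ≠ 0) (hv : v ≠ 0)
    (huv : u + v ≠ 0) {n : ℕ} (hn : n ≠ 2) :
    ∑ p ∈ Finset.HasAntidiagonal.antidiagonal n, (seriesCoeff p.1 * seriesCoeff p.2) •
      (v * (u ^ p.1 * ((u + v) ^ p.2 - v ^ p.2)) - u * (v ^ p.1 * (u ^ p.2 - (u + v) ^ p.2))) =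
      0 := by
  have h := congrArg (PowerSeries.coeff n) (series_addition hu hv huv)
  rw [PowerSeries.coeff_C_mul, PowerSeries.coeff_X_pow, if_neg hn, mul_zero, map_sub,
    PowerSeries.coeff_C_mul, PowerSeries.coeff_C_mul, map_sub, map_sub] at h
  simp only [PowerSeries.coeff_mul, coeff_series] at h
  rw [← h]
  simp only [← Finset.sum_sub_distrib, Finset.mul_sum]
  refine Finset.sum_congr rfl fun p _ => ?_
  simp only [Algebra.smul_def, map_mul]
  ring

/-- The alternating sum over the natural numbers `l` with `k ≤ l + b` and `l ≤ a`. -/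
def altSumNat (a b k : ℕ) : ℚ :=
  ∑ l ∈ Finset.range (k + 1), if k ≤ l + b ∧ l ≤ a then (-1) ^ l * (k.choose l : ℚ) else 0

theorem dividedDiff_eq_sum (k m : ℕ) (x y z : R) : dividedDiff k m x y z =
    ∑ l ∈ Finset.range (k + 1), ∑ c ∈ Finset.range (m + 1), ∑ i ∈ Finset.range (m - c),
      ((-1) ^ (k - l) * (k.choose l : ℚ) * ((-1) ^ c * (m.choose c : ℚ))) •
        (x ^ (l + i) * y ^ (k - l + (m - c - 1 - i)) * z ^ c) := by
  rw [dividedDiff, sub_eq_add_neg, add_pow, Finset.sum_mul]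
  refine Finset.sum_congr rfl fun l _ => ?_
  rw [Finset.mul_sum]
  refine Finset.sum_congr rfl fun c _ => ?_
  rw [Finset.mul_sum, Finset.mul_sum]
  refine Finset.sum_congr rfl fun i _ => ?_
  rw [neg_pow y, neg_pow z, Algebra.smul_def]
  push_cast
  simp only [pow_add]
  ring

/-- For each `l` only `i = a - l` can give the monomial `x ^ a y ^ b z ^ c`, and it is in range
exactly when `k - b ≤ l ≤ a`. Evenness of `k` turns `(-1) ^ (k - l)` into `(-1) ^ l`. -/
theorem map_dividedDiff {a b c k m : ℕ} (hk : Even k) (h : a + b + c + 1 = k + m) {x y z : R}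
    (φ : R →ₗ[ℚ] ℚ)
    (hφ : ∀ i j l, φ (x ^ i * y ^ j * z ^ l) = if i = a ∧ j = b ∧ l = c then 1 else 0) :
    φ (dividedDiff k m x y z) = (-1) ^ c * (m.choose c : ℚ) * altSumNat a b k := by
  rw [dividedDiff_eq_sum]
  simp only [map_sum, map_smul, hφ, smul_eq_mul]
  rw [altSumNat, Finset.mul_sum]
  refine Finset.sum_congr rfl fun l hl => ?_
  have hl' : l ≤ k := Nat.lt_succ_iff.1 (Finset.mem_range.1 hl)
  rw [Finset.sum_eq_single c]
  · by_cases hcond : k ≤ l + b ∧ l ≤ a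
    · rw [if_pos hcond, Finset.sum_eq_single (a - l)]
      · rw [if_pos ⟨by omega, by omega, rfl⟩]
        have : (-1 : ℚ) ^ (k - l) = (-1) ^ l := by
          have h1 : (-1 : ℚ) ^ (k - l) * (-1) ^ l = 1 := by
            rw [← pow_add, Nat.sub_add_cancel hl', hk.neg_one_pow]
          have h2 : (-1 : ℚ) ^ l * (-1) ^ l = 1 := by rw [← mul_pow]; simp
          linear_combination (-1 : ℚ) ^ l * h1 - (-1 : ℚ) ^ (k - l) * h2
        rw [this]
        ring
      · intro i _ hi
        rw [if_neg (by omega), mul_zero]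
      · intro hi
        rw [Finset.mem_range] at hi
        omega
    · rw [if_neg hcond, mul_zero]
      refine Finset.sum_eq_zero fun i hi => ?_
      rw [Finset.mem_range] at hi
      rw [if_neg (by omega), mul_zero]
  · intro c' _ hc
    exact Finset.sum_eq_zero fun i _ => by rw [if_neg (by omega), mul_zero]
  · intro hc
    rw [Finset.mem_range] at hc
    exact Finset.sum_eq_zero fun i hi => by
      rw [Finset.mem_range] at hi
      omega

end CommRing

theorem sum_dividedDiff_eq_zero {R : Type*} [CommRing R] [Algebra ℚ R] [IsDomain R] {x y z : R}
    (hxy : x ≠ y) (hyz : y ≠ z) (hxz : x ≠ z) {n : ℕ} (hn : Even n) (hn2 : n ≠ 2) :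
    ∑ p ∈ Finset.HasAntidiagonal.antidiagonal n, (seriesCoeff p.1 * seriesCoeff p.2) •
      (dividedDiff p.1 p.2 x y z - dividedDiff p.1 p.2 z y x) = 0 := by
  have hu := sub_ne_zero.2 hxy
  have hv := sub_ne_zero.2 hyz
  have huv : x - y + (y - z) ≠ 0 := by simpa using sub_ne_zero.2 hxz
  refine mul_right_cancel₀ (mul_ne_zero hu hv) ?_
  rw [zero_mul, ← sum_seriesCoeff_eq_zero hu hv huv hn2, Finset.sum_mul]
  refine Finset.sum_congr rfl fun p hp => ?_
  rw [smul_mul_assoc]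
  rcases Nat.even_or_odd p.1 with h1 | h1
  · have h2 : Even p.2 := by
      rw [← Finset.HasAntidiagonal.mem_antidiagonal.1 hp, Nat.even_add] at hn
      exact hn.1 h1
    congr 1
    have e1 := dividedDiff_mul p.1 p.2 x y z
    have e2 := dividedDiff_mul p.1 p.2 z y x
    -- Both exponents are even here, so reversing the differences in the powers costs no sign.
    rw [← neg_sub y z, ← neg_sub x z, ← neg_sub x y, h1.neg_pow, h2.neg_pow, h2.neg_pow] at e2
    rw [sub_add_sub_cancel]
    linear_combination (y - z) * e1 + (x - y) * e2
  · rw [seriesCoeff_of_odd h1, zero_mul, zero_smul, zero_smul]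

/-- The polynomial identity is taken in `ℚ[x, y, z]`. Exchanging `x` and `z` exchanges `a` and `c`,
which produces the second half of `λ_k`. -/
theorem sum_altSumNat_eq_zero {a b c n : ℕ} (hn : Even n) (hn2 : n ≠ 2)
    (h : a + b + c + 1 = n) :
    ∑ p ∈ Finset.HasAntidiagonal.antidiagonal n, seriesCoeff p.1 * seriesCoeff p.2 *
      ((-1) ^ c * (p.2.choose c : ℚ) * altSumNat a b p.1 -
        (-1) ^ a * (p.2.choose a : ℚ) * altSumNat c b p.1) = 0 := by
  let X : Fin 3 → MvPolynomial (Fin 3) ℚ := MvPolynomial.X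
  have hX : ∀ i j : Fin 3, i ≠ j → X i ≠ X j := fun i j hij e =>
    hij (MvPolynomial.X_injective e)
  let φ : MvPolynomial (Fin 3) ℚ →ₗ[ℚ] ℚ := MvPolynomial.lcoeff ℚ
    (Finsupp.single 0 a + Finsupp.single 1 b + Finsupp.single 2 c)
  have hφ : ∀ i j l, φ (X 0 ^ i * X 1 ^ j * X 2 ^ l) =
      if i = a ∧ j = b ∧ l = c then 1 else 0 := fun i j l => by
    change MvPolynomial.coeff _ _ = _
    simp only [X, MvPolynomial.X_pow_eq_monomial, MvPolynomial.monomial_mul, mul_one,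
      MvPolynomial.coeff_monomial]
    refine if_congr ?_ rfl rfl
    simp [DFunLike.ext_iff, Fin.forall_fin_succ]
  have key := congrArg φ (sum_dividedDiff_eq_zero (hX 0 1 (by decide)) (hX 1 2 (by decide))
    (hX 0 2 (by decide)) hn hn2)
  rw [map_sum, map_zero] at key
  rw [← key]
  refine Finset.sum_congr rfl fun p hp => ?_
  have hp' := Finset.HasAntidiagonal.mem_antidiagonal.1 hp
  rw [map_smul, map_sub, smul_eq_mul]
  rcases Nat.even_or_odd p.1 with h1 | h1
  · rw [map_dividedDiff h1 (by omega) φ hφ, map_dividedDiff (a := c) (b := b) (c := a) h1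
      (by omega) φ]
    intro i j l
    rw [mul_comm, ← mul_assoc, mul_right_comm, hφ]
    exact if_congr (by tauto) rfl rfl
  · rw [seriesCoeff_of_odd h1, zero_mul, zero_mul, zero_mul]

/-! ### Passage to the stated coefficients -/

theorem altSum_natCast (a b k : ℕ) : altSum a b k = altSumNat a b k := by
  rw [altSumNat, ← Finset.sum_filter, altSum]
  refine Finset.sum_bij' (fun l _ => l.toNat) (fun l _ => (l : ℤ)) ?_ ?_ ?_ ?_ ?_
  · intro l hl
    simp only [Finset.mem_Icc, Finset.mem_filter, Finset.mem_range] at *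
    omega
  · intro l hl
    simp only [Finset.mem_Icc, Finset.mem_filter, Finset.mem_range] at *
    omega
  · intro l hl
    simp only [Finset.mem_Icc] at hl
    exact Int.toNat_of_nonneg (by omega)
  · intro l _
    exact Int.toNat_natCast l
  · intro l hl
    simp only [Finset.mem_Icc] at hl
    obtain ⟨l, rfl⟩ := Int.eq_ofNat_of_zero_le (show 0 ≤ l by omega)
    simp [binom]

theorem altSum_eq_zero_of_neg {a b : ℤ} (h : a < 0 ∨ b < 0) (k : ℕ) : altSum a b k = 0 := by
  rw [altSum, Finset.Icc_eq_empty (by omega), Finset.sum_empty]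

theorem binom_natCast (m r : ℕ) : binom m r = m.choose r := by simp [binom]

theorem binom_of_neg (m : ℕ) {r : ℤ} (h : r < 0) : binom m r = 0 := by
  simp [binom, not_le.2 h]

theorem eulerCoeff_eq_zero_of_neg (n : ℕ) {a b c : ℤ} (h : a < 0 ∨ b < 0 ∨ c < 0) (k : ℕ) :
    eulerCoeff n a b c k = 0 := by
  rcases h with h | h | h
  · simp [eulerCoeff, altSum_eq_zero_of_neg (Or.inl h), binom_of_neg _ h]
  · simp [eulerCoeff, altSum_eq_zero_of_neg (Or.inr h)]
  · simp [eulerCoeff, altSum_eq_zero_of_neg (Or.inl h), binom_of_neg _ h]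

/-- For odd `k` both sides vanish, since `n ≠ 2` excludes the product `B_1 B_1`. The `4` absorbs the
factor `2` in each `seriesCoeff`. -/
theorem choose_mul_bernoulli_mul_bernoulli {n k m : ℕ} (hn : Even n) (hn2 : n ≠ 2)
    (h : k + m = n) : (n.choose k : ℚ) * bernoulli k * bernoulli m =
      n.factorial / 4 * (seriesCoeff k * seriesCoeff m) := by
  rcases Nat.even_or_odd k with hk | hk
  · have hm : Even m := by
      rw [← h, Nat.even_add] at hn
      exact hn.1 hk
    have hk1 : k ≠ 1 := by rintro rfl; simp at hk
    have hm1 : m ≠ 1 := by rintro rfl; simp at hm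
    have h1 : (k.factorial : ℚ) ≠ 0 := by exact_mod_cast k.factorial_ne_zero
    have h2 : (m.factorial : ℚ) ≠ 0 := by exact_mod_cast m.factorial_ne_zero
    have h4 : (n.choose k : ℚ) * k.factorial * m.factorial = n.factorial := by
      subst h
      rw [Nat.choose_symm_add]
      exact_mod_cast Nat.add_choose_mul_factorial_mul_factorial k m
    rw [seriesCoeff, seriesCoeff, if_neg hk1, if_neg hm1, ← h4]
    field_simp
    ring
  · have hm : Odd m := by
      rw [← h, Nat.even_add, ← Nat.not_odd_iff_even] at hn
      by_contra hm
      exact hn.2 (Nat.not_odd_iff_even.1 hm) hk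
    rw [seriesCoeff_of_odd hk, zero_mul, mul_zero]
    by_cases hk1 : k = 1
    · have : 1 < m := by
        obtain ⟨j, rfl⟩ := hm
        omega
      rw [bernoulli_eq_zero_of_odd hm this, mul_zero]
    · have : 1 < k := by
        obtain ⟨j, rfl⟩ := hk
        omega
      rw [bernoulli_eq_zero_of_odd hk this, mul_zero, zero_mul]

end EulerTypeIdentities

open EulerTypeIdentities

/-- The Euler-type identities hold. -/
theorem eulerTypeIdentities : EulerTypeIdentities := by
  intro n hn hn4 a b c habc
  by_cases hneg : a < 0 ∨ b < 0 ∨ c < 0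
  · exact Finset.sum_eq_zero fun k _ => by rw [eulerCoeff_eq_zero_of_neg n hneg]; simp
  push Not at hneg
  obtain ⟨ha, hb, hc⟩ := hneg
  lift a to ℕ using ha
  lift b to ℕ using hb
  lift c to ℕ using hc
  rw [← Finset.Nat.sum_antidiagonal_eq_sum_range_succ
    (fun k m => eulerCoeff n a b c k * bernoulli k * bernoulli m)]
  have hn2 : n ≠ 2 := by omega
  have key := sum_altSumNat_eq_zero (a := a) (b := b) (c := c) hn hn2 (by omega)
  rw [← mul_zero ((n.factorial : ℚ) / 4), ← key, Finset.mul_sum]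
  refine Finset.sum_congr rfl fun p hp => ?_
  have hp' := Finset.HasAntidiagonal.mem_antidiagonal.1 hp
  have hsub : n - p.1 = p.2 := by omega
  have h := choose_mul_bernoulli_mul_bernoulli hn hn2 hp'
  simp only [eulerCoeff, binom_natCast, altSum_natCast, hsub, zpow_natCast]
  linear_combination ((-1) ^ c * (p.2.choose c : ℚ) * altSumNat a b p.1 -
        (-1) ^ a * (p.2.choose a : ℚ) * altSumNat c b p.1) * h

end

theorem mainTheorem5 (K : Type*) [Field K] [CharZero K] :
    List.TFAE [EulerTypeIdentities, LawrenceSullivanTheorem K, TensorDifferentialTheorem K] := by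
  -- All three statements are theorems, so each is compared with `True`.
  refine List.tfae_of_forall True _ fun p hp => ?_
  simp only [List.mem_cons, List.not_mem_nil, or_false] at hp
  rcases hp with rfl | rfl | rfl
  · exact iff_of_true eulerTypeIdentities trivial
  · exact iff_of_true (NCSeries.lawrenceSullivanTheorem K) trivial
  · exact iff_of_true (NCSeries.tensorDifferentialTheorem K) trivial
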